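/- For sets $A,B,C$ and relations $R_1\subseteq A\times B$, $R_2\subseteq B\times C$ write $\mathrm{Dom}(R_1)=\{a:\exists b\,(a,b)\in R_1\}$, $\mathrm{Img}(R_1)=\{b:\exists a\,(a,b)\in R_1\}$ and $R_1\circ R_2=\{(a,c):\exists b\,((a,b)\in R_1\wedge(b,c)\in R_2)\}$. With respect to $R\subseteq A\times C$, the pair $(R_1,R_2)$ meets the TD condition if $\mathrm{Img}(R_1)\subseteq \mathrm{Dom}(R_2)$ and $R_1\circ R_2=R$; it meets the PD condition if $\mathrm{Img}(R_1)\subseteq \mathrm{Dom}(R_2)$, $\mathrm{Dom}(R_1\circ R_2)=\mathrm{Dom}(R)$ and $R_1\circ R_2\subseteq R$. Consider the following decision problems. The input consists of natural numbers $n_I,n_O,n_B$, a Boolean circuit $C_R$ with $n_I+n_O$ inputs describing a relation $R\subseteq\{0,1\}^{n_I}\times\{0,1\}^{n_O}$, and a second Boolean circuit, the hint, encoded as a binary word. (Circuits are listed as usual with all their input nodes and gates; in particular $n_I,n_O,n_B$ are bounded by the length of the input.) 1. TDP (respectively PDP) for symbolic relations with a hint $C_{R_1}$: the hint is a circuit $C_{R_1}$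 with $n_I+n_B$ inputs describing $R_1\subseteq\{0,1\}^{n_I}\times\{0,1\}^{n_B}$, and the question is whether there is a relation $R_2\subseteq\{0,1\}^{n_B}\times\{0,1\}^{n_O}$ such that $(R_1,R_2)$ meets the TD (respectively PD) condition with respect to $R$. 2. TDP (respectively PDP) for symbolic relations with a hint $C_{R_2}$: the hint is a circuit $C_{R_2}$ with $n_B+n_O$ inputs describing $R_2\subseteq\{0,1\}^{n_B}\times\{0,1\}^{n_O}$, and the question is whether there is a relation $R_1\subseteq\{0,1\}^{n_I}\times\{0,1\}^{n_B}$ such that $(R_1,R_2)$ meets the TD (respectively PD) condition with respect to $R$. **Theorem.** All four problems are in $\Pi_3^P$: for each of them, with $L\subseteq\{0,1\}^*$ the set of words encoding a yes-instance, there are a polynomial $q$ and a polynomial-time decidable predicate $V$ such that for all $x\in\{0,1\}^*$ $$x\in L\iff \forall u\in\{0,1\}^{q(|x|)}\ \exists v\in\{0,1\}^{q(|x|)}\ \forall w\in\{0,1\}^{q(|x|)}\ V(x,u,v,w).$$ -/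

import Mathlib

namespace SeqDecomp

/-! ### Decomposition of relations

Mathlib's `SetRel α β` is the type of binary relations as subsets of `α × β`; `R.dom`, `R.cod`
are the domain and the image of `R`, and `R₁.comp R₂` is the composition
`{(a, c) | ∃ b, (a, b) ∈ R₁ ∧ (b, c) ∈ R₂}`. -/

/-- The TD condition for `(R₁, R₂)` with respect to `R`. -/
def TDCondition {A B C : Type} (R : SetRel A C) (R₁ : SetRel A B) (R₂ : SetRel B C) : Prop :=
  R₁.cod ⊆ R₂.dom ∧ R₁.comp R₂ = R

/-- The PD condition for `(R₁, R₂)` with respect to `R`. -/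
def PDCondition {A B C : Type} (R : SetRel A C) (R₁ : SetRel A B) (R₂ : SetRel B C) : Prop :=
  R₁.cod ⊆ R₂.dom ∧ (R₁.comp R₂).dom = R.dom ∧ R₁.comp R₂ ⊆ R

/-! ### Boolean circuits -/

/-- A gate whose arguments are taken among `n` already available wires. -/
inductive Gate (n : ℕ) : Type
  | const (b : Bool) : Gate n
  | not (i : Fin n) : Gate n
  | and (i j : Fin n) : Gate n
  | or (i j : Fin n) : Gate n

/-- The value of a gate, given the values `w` of the available wires. -/
def Gate.eval {n : ℕ} (w : Fin n → Bool) : Gate n → Bool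
  | .const b => b
  | .not i => !(w i)
  | .and i j => w i && w j
  | .or i j => w i || w j

/-- A Boolean circuit (with fan-out) given as its list of gates in topological order:
`Circuit n` is a circuit with the available wires `0, …, n - 1`. It either designates one of them
as the output, or adds a gate, whose value is carried by the new wire `n`, and continues with
`n + 1` wires. A circuit with `n` inputs is an element of `Circuit n`, its first `n` wires being
the input nodes. -/
inductive Circuit : ℕ → Type
  | output {n : ℕ} (i : Fin n) : Circuit n
  | gate {n : ℕ} (g : Gate n) (rest : Circuit (n + 1)) : Circuit n

/-- The value of a circuit, given the values `w` of the available wires. -/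
def Circuit.eval : {n : ℕ} → Circuit n → (Fin n → Bool) → Bool
  | _, .output i, w => w i
  | _, .gate g rest, w => rest.eval (Fin.snoc (α := fun _ => Bool) w (g.eval w))

/-- The domain `{0,1}ⁿ`. -/
abbrev Cube (n : ℕ) : Type := Fin n → Bool

/-- The relation on `{0,1}ᵐ × {0,1}ⁿ` described by a circuit with `m + n` inputs. -/
def Circuit.rel {m n : ℕ} (c : Circuit (m + n)) : SetRel (Cube m) (Cube n) :=
  {p | c.eval (Fin.append p.1 p.2) = true}

/-! ### Binary words describing circuits and problem instances -/

/-- The self-delimiting unary code `1ᵏ0` of a number. -/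
def codeNat (k : ℕ) : List Bool := List.replicate k true ++ [false]

/-- The code of a gate: two bits for its kind, followed by its arguments. -/
def Gate.code {n : ℕ} : Gate n → List Bool
  | .const b => [false, false, b]
  | .not i => false :: true :: codeNat i
  | .and i j => true :: false :: (codeNat i ++ codeNat j)
  | .or i j => true :: true :: (codeNat i ++ codeNat j)

/-- The code of a circuit: its gates in order, each announced by the bit `1`, and then the bit `0`
and the index of its output wire. The number of input nodes is coded separately. -/
def Circuit.code : {n : ℕ} → Circuit n → List Bool
  | _, .output i => false :: codeNat i
  | _, .gate g rest => true :: (g.code ++ rest.code)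

/-- An instance of the symbolic decomposition problems with a hint for the first component:
the dimensions of the three domains `{0,1}^nI`, `{0,1}^nO`, `{0,1}^nB`, a circuit for the relation
to be decomposed, and a circuit for the hint. -/
structure HintOneInstance where
  nI : ℕ
  nO : ℕ
  nB : ℕ
  circR : Circuit (nI + nO)
  circR₁ : Circuit (nI + nB)

/-- An instance of the symbolic decomposition problems with a hint for the second component. -/
structure HintTwoInstance where
  nI : ℕ
  nO : ℕ
  nB : ℕ
  circR : Circuit (nI + nO)
  circR₂ : Circuit (nB + nO)

/-- The word describing an instance. The words `1^nI 0`, `1^nO 0`, `1^nB 0` list the input nodes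
of the circuits one by one; the gates of the two circuits follow. -/
def HintOneInstance.code (I : HintOneInstance) : List Bool :=
  codeNat I.nI ++ codeNat I.nO ++ codeNat I.nB ++ I.circR.code ++ I.circR₁.code

/-- The word describing an instance, as for the other kind of hint. -/
def HintTwoInstance.code (I : HintTwoInstance) : List Bool :=
  codeNat I.nI ++ codeNat I.nO ++ codeNat I.nB ++ I.circR.code ++ I.circR₂.code

/-! ### The four decision problems, as languages -/

/-- TDP for symbolic relations with a hint `C_{R₁}`. -/
def symbolicTDPHintOne : Language Bool :=
  {x | ∃ I : HintOneInstance, I.code = x ∧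
    ∃ R₂ : SetRel (Cube I.nB) (Cube I.nO), TDCondition I.circR.rel I.circR₁.rel R₂}

/-- PDP for symbolic relations with a hint `C_{R₁}`. -/
def symbolicPDPHintOne : Language Bool :=
  {x | ∃ I : HintOneInstance, I.code = x ∧
    ∃ R₂ : SetRel (Cube I.nB) (Cube I.nO), PDCondition I.circR.rel I.circR₁.rel R₂}

/-- TDP for symbolic relations with a hint `C_{R₂}`. -/
def symbolicTDPHintTwo : Language Bool :=
  {x | ∃ I : HintTwoInstance, I.code = x ∧
    ∃ R₁ : SetRel (Cube I.nI) (Cube I.nB), TDCondition I.circR.rel R₁ I.circR₂.rel}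

/-- PDP for symbolic relations with a hint `C_{R₂}`. -/
def symbolicPDPHintTwo : Language Bool :=
  {x | ∃ I : HintTwoInstance, I.code = x ∧
    ∃ R₁ : SetRel (Cube I.nI) (Cube I.nB), PDCondition I.circR.rel R₁ I.circR₂.rel}

/-! ### The class `Π₃ᴾ` -/

/-- Mathlib's encoding of a quadruple `(x, u, v, w)` of binary words as one word over a finite
alphabet: the concatenation `xuvw`, every letter being marked with the component it belongs to. -/
def quadEncoding : Computability.Encoding (List Bool × List Bool × List Bool × List Bool)
    (Bool ⊕ (Bool ⊕ (Bool ⊕ Bool))) :=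
  Computability.encodingProd (Computability.encodingList Bool)
    (Computability.encodingProd (Computability.encodingList Bool)
      (Computability.encodingProd (Computability.encodingList Bool)
        (Computability.encodingList Bool)))

/-- The third `Π`-level of the polynomial hierarchy: the languages `L` of binary words for which
there are a polynomial `q` and a predicate `V`, decided by a (multi-stack) Turing machine in
polynomial time, such that `x ∈ L` iff
`∀ u ∈ {0,1}^q(|x|), ∃ v ∈ {0,1}^q(|x|), ∀ w ∈ {0,1}^q(|x|), V(x, u, v, w)`. -/
def PiThreeP : Set (Language Bool) :=
  {L | ∃ (q : Polynomial ℕ) (V : List Bool × List Bool × List Bool × List Bool → Bool),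
    Nonempty (Turing.TM2ComputableInPolyTime quadEncoding.encode Computability.encodeBool V) ∧
    ∀ x : List Bool, x ∈ L ↔
      ∀ u : List Bool, u.length = q.eval x.length →
        ∃ v : List Bool, v.length = q.eval x.length ∧
          ∀ w : List Bool, w.length = q.eval x.length → V (x, u, v, w) = true}

/-! ### The codes are uniquely readable -/

theorem codeNat_append_inj {a b : ℕ} {s t : List Bool}
    (h : codeNat a ++ s = codeNat b ++ t) : a = b ∧ s = t := by
  induction a generalizing b with
  | zero => cases b <;> simp_all [codeNat, List.replicate_succ]
  | succ a ih =>
    cases b with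
    | zero => simp_all [codeNat, List.replicate_succ]
    | succ b =>
      have := @ih b (by simpa [codeNat, List.replicate_succ] using h)
      simpa using this

theorem Gate.code_append_inj {n : ℕ} {g g' : Gate n} {s t : List Bool}
    (h : g.code ++ s = g'.code ++ t) : g = g' ∧ s = t := by
  cases g <;> cases g' <;> simp [Gate.code] at h
  · exact ⟨by rw [h.1], h.2⟩
  · obtain ⟨h1, h2⟩ := codeNat_append_inj h
    exact ⟨by rw [Fin.ext h1], h2⟩
  all_goals
    obtain ⟨h1, h2⟩ := codeNat_append_inj h
    obtain ⟨h3, h4⟩ := codeNat_append_inj h2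
    exact ⟨by rw [Fin.ext h1, Fin.ext h3], h4⟩

theorem Circuit.code_append_inj {n : ℕ} {c c' : Circuit n} {s t : List Bool}
    (h : c.code ++ s = c'.code ++ t) : c = c' ∧ s = t := by
  induction c with
  | output i =>
    cases c' with
    | output j =>
      simp [Circuit.code] at h
      obtain ⟨h1, h2⟩ := codeNat_append_inj h
      exact ⟨by rw [Fin.ext h1], h2⟩
    | gate g r => simp [Circuit.code] at h
  | gate g r ih =>
    cases c' with
    | output j => simp [Circuit.code] at h
    | gate g' r' =>
      simp [Circuit.code] at h
      obtain ⟨h1, h2⟩ := Gate.code_append_inj h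
      obtain ⟨h3, h4⟩ := ih h2
      exact ⟨by rw [h1, h3], h4⟩

theorem HintOneInstance.code_injective : Function.Injective HintOneInstance.code := by
  rintro ⟨a, b, c, r, s⟩ ⟨a', b', c', r', s'⟩ h
  simp only [HintOneInstance.code, List.append_assoc] at h
  obtain ⟨rfl, h⟩ := codeNat_append_inj h
  obtain ⟨rfl, h⟩ := codeNat_append_inj h
  obtain ⟨rfl, h⟩ := codeNat_append_inj h
  obtain ⟨rfl, h⟩ := Circuit.code_append_inj h
  obtain ⟨rfl, -⟩ := Circuit.code_append_inj (s := []) (t := []) (by simpa using h)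
  rfl

theorem HintTwoInstance.code_injective : Function.Injective HintTwoInstance.code := by
  rintro ⟨a, b, c, r, s⟩ ⟨a', b', c', r', s'⟩ h
  simp only [HintTwoInstance.code, List.append_assoc] at h
  obtain ⟨rfl, h⟩ := codeNat_append_inj h
  obtain ⟨rfl, h⟩ := codeNat_append_inj h
  obtain ⟨rfl, h⟩ := codeNat_append_inj h
  obtain ⟨rfl, h⟩ := Circuit.code_append_inj h
  obtain ⟨rfl, -⟩ := Circuit.code_append_inj (s := []) (t := []) (by simpa using h)
  rfl

end SeqDecomp

/-! When one component is given, there is a largest candidate for the other. Given R₁, every R₂ with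
R₁∘R₂ ⊆ R lies in the residual, the set of (b,c) such that (a,b) ∈ R₁ implies (a,c) ∈ R for all a.
Given R₂, every admissible R₁ lies in the set of (a,b) with b ∈ Dom(R₂) such that (b,c) ∈ R₂ implies
(a,c) ∈ R for all c. The remaining requirements only get easier when the candidate grows, so a
solution exists iff the largest candidate is one.

Spelled out, this is a ∀∃∀ statement: for each given pair there is a witness b or c, and membership
in the candidate is one more universal quantifier. Since cubes are nonempty, the quantifiers can be
pulled to the front and the requirements merged; see `exists_tdCondition_left` and its three
companions.

The matrix is then a Boolean combination of values of the two circuits at points assembled from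
three quantified triples (a,c,b). A triple fits into a word of length |x| because the dimensions are
coded in unary. The polynomial-time predicate is an explicit multi-stack machine. Its wires carry
nine bits, one for each choice of a first and a second block among the three words, so a single pass
through the gates evaluates a circuit at all nine points, and one machine, parametrized by the kind
of hint and a final function `acc`, serves all four problems. The heart of its analysis is
`circuit_spec`; `run_spec` and `verifier_polyTime` assemble the run and the time bound. Words that
code no instance are rejected, and unique readability ties the machine's answer to the instance
(`verifier_rawCode`). `mem_piThreeP` joins the two halves. -/

namespace SeqDecomp

open Turing

/-! ### A machine evaluating two circuits at nine points

The three quantified words play the roles `0`, `1`, `2`. A wire carries the values of a gate at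
the nine points whose first block is read off the word `p` and whose second block is read off the
word `q`. -/

/-- The values of a wire at the nine evaluation points. -/
abbrev Wire : Type := Fin 3 → Fin 3 → Bool

/-- The input alphabet: bits of `x`, `u`, `v` and `w`. -/
abbrev Quad : Type := Bool ⊕ (Bool ⊕ (Bool ⊕ Bool))

/-- The stacks of the machine. -/
inductive Stk : Type
  | inp | rev | code | wordU | wordV | wordW | wires | temp | left | right
  deriving DecidableEq

instance : Fintype Stk where
  elems := {.inp, .rev, .code, .wordU, .wordV, .wordW, .wires, .temp, .left, .right}
  complete k := by cases k <;> decide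

/-- The alphabets of the stacks. -/
abbrev Stk.Sym : Stk → Type
  | .inp => Quad
  | .rev => Bool
  | .code => Bool
  | .wordU => Bool
  | .wordV => Bool
  | .wordW => Bool
  | .wires => Wire
  | .temp => Wire
  | .left => Wire
  | .right => Wire

/-- The contents of all stacks. -/
@[ext]
structure Store where
  inp : List Quad := []
  rev : List Bool := []
  code : List Bool := []
  wordU : List Bool := []
  wordV : List Bool := []
  wordW : List Bool := []
  wires : List Wire := []
  temp : List Wire := []
  left : List Wire := []
  right : List Wire := []

/-- The stack contents as a function of the stack. -/
def Store.stk (s : Store) : ∀ k : Stk, List k.Sym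
  | .inp => s.inp
  | .rev => s.rev
  | .code => s.code
  | .wordU => s.wordU
  | .wordV => s.wordV
  | .wordW => s.wordW
  | .wires => s.wires
  | .temp => s.temp
  | .left => s.left
  | .right => s.right

section Update
variable (s : Store)

@[simp] theorem Store.stk_inp : s.stk .inp = s.inp := rfl
@[simp] theorem Store.stk_rev : s.stk .rev = s.rev := rfl
@[simp] theorem Store.stk_code : s.stk .code = s.code := rfl
@[simp] theorem Store.stk_wordU : s.stk .wordU = s.wordU := rfl
@[simp] theorem Store.stk_wordV : s.stk .wordV = s.wordV := rfl
@[simp] theorem Store.stk_wordW : s.stk .wordW = s.wordW := rfl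
@[simp] theorem Store.stk_wires : s.stk .wires = s.wires := rfl
@[simp] theorem Store.stk_temp : s.stk .temp = s.temp := rfl
@[simp] theorem Store.stk_left : s.stk .left = s.left := rfl
@[simp] theorem Store.stk_right : s.stk .right = s.right := rfl

@[simp] theorem Store.update_inp (l : List Quad) :
    Function.update s.stk .inp l = { s with inp := l }.stk := by
  funext k; cases k <;> rfl
@[simp] theorem Store.update_rev (l : List Bool) :
    Function.update s.stk .rev l = { s with rev := l }.stk := by
  funext k; cases k <;> rfl
@[simp] theorem Store.update_code (l : List Bool) :
    Function.update s.stk .code l = { s with code := l }.stk := by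
  funext k; cases k <;> rfl
@[simp] theorem Store.update_wordU (l : List Bool) :
    Function.update s.stk .wordU l = { s with wordU := l }.stk := by
  funext k; cases k <;> rfl
@[simp] theorem Store.update_wordV (l : List Bool) :
    Function.update s.stk .wordV l = { s with wordV := l }.stk := by
  funext k; cases k <;> rfl
@[simp] theorem Store.update_wordW (l : List Bool) :
    Function.update s.stk .wordW l = { s with wordW := l }.stk := by
  funext k; cases k <;> rfl
@[simp] theorem Store.update_wires (l : List Wire) :
    Function.update s.stk .wires l = { s with wires := l }.stk := by
  funext k; cases k <;> rfl
@[simp] theorem Store.update_temp (l : List Wire) :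
    Function.update s.stk .temp l = { s with temp := l }.stk := by
  funext k; cases k <;> rfl
@[simp] theorem Store.update_left (l : List Wire) :
    Function.update s.stk .left l = { s with left := l }.stk := by
  funext k; cases k <;> rfl
@[simp] theorem Store.update_right (l : List Wire) :
    Function.update s.stk .right l = { s with right := l }.stk := by
  funext k; cases k <;> rfl

end Update

/-- What to do with the next wire to be looked up: return it as the output, or use it as an
argument of a gate. -/
inductive Op : Type
  | out
  | not
  | bin (isOr : Bool)
  | bin' (isOr : Bool) (arg : Wire)
  deriving Fintype

/-- The three blocks of input nodes. -/
inductive Blk : Type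
  | I | O | B
  deriving DecidableEq

instance : Fintype Blk where
  elems := {.I, .O, .B}
  complete j := by cases j <;> decide

/-- The labels of the machine. The argument `m : Option Wire` of several labels is `none` during
the evaluation of the first circuit, and the value of the first circuit afterwards. -/
inductive Lab : Type
  /-- distribute the input onto the stacks -/
  | split
  /-- reverse the instance code -/
  | rev
  /-- read the dimension of a block -/
  | rd (j : Blk)
  /-- read the next gate -/
  | gate (m : Option Wire)
  /-- move the wires to the temporary stack -/
  | mv (m : Option Wire) (op : Op)
  /-- skip as many wires as the index in the code says -/
  | idx (m : Option Wire) (op : Op)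
  /-- move the wires back and use the wire that was found -/
  | back (m : Option Wire) (op : Op) (val : Wire)
  /-- discard the wires of the first circuit -/
  | clr (r : Wire)
  /-- move the left block of input nodes of the second circuit in two steps -/
  | left (r : Wire)
  | left' (r : Wire)
  /-- move the right block of input nodes of the second circuit in two steps -/
  | right (r : Wire)
  | right' (r : Wire)
  /-- check that the code has been read completely -/
  | chk (res : Bool)
  /-- empty all stacks and write the result -/
  | clean (res : Bool)

/-- An injective tag on labels. -/
def Lab.tag : Lab → Fin 14 × Blk × Option Wire × Op × Wire × Bool
  | .split => (0, .I, none, .out, default, false)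
  | .rev => (1, .I, none, .out, default, false)
  | .rd j => (2, j, none, .out, default, false)
  | .gate m => (3, .I, m, .out, default, false)
  | .mv m op => (4, .I, m, op, default, false)
  | .idx m op => (5, .I, m, op, default, false)
  | .back m op val => (6, .I, m, op, val, false)
  | .clr r => (7, .I, none, .out, r, false)
  | .left r => (8, .I, none, .out, r, false)
  | .left' r => (9, .I, none, .out, r, false)
  | .right r => (10, .I, none, .out, r, false)
  | .right' r => (11, .I, none, .out, r, false)
  | .chk res => (12, .I, none, .out, default, res)
  | .clean res => (13, .I, none, .out, default, res)

/-- Labels may store wires, in particular the value of the first circuit, because a wire has only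
finitely many possible values. -/
instance : Finite Lab :=
  Finite.of_injective Lab.tag fun a b h => by
    cases a <;> cases b <;> simp_all [Lab.tag]

/-- The internal state of the machine. -/
structure Reg where
  sym : Option Quad := none
  b : Option Bool := none
  b₁ : Option Bool := none
  b₂ : Option Bool := none
  bu : Bool := false
  bv : Bool := false
  bw : Bool := false
  y : Option Wire := none

instance : Finite Reg :=
  Finite.of_injective
    (fun r : Reg => ((r.sym, r.b, r.b₁, r.b₂), (r.bu, r.bv, r.bw, r.y)))
    fun a b h => by cases a; cases b; simp_all

/-- The wire carrying the bits of the first block. -/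
def rowWire (a b c : Bool) : Wire := fun p _ => ![a, b, c] p

/-- The wire carrying the bits of the second block. -/
def colWire (a b c : Bool) : Wire := fun _ q => ![a, b, c] q

section Program
open TM2.Stmt

/-- The statements of the machine. -/
abbrev Code : Type := TM2.Stmt Stk.Sym Lab Reg

/-- Pop a bit of each of the three words, reading missing bits as `false`. -/
def popWord (q : Code) : Code :=
  pop .wordU (fun r o => { r with bu := o.getD false }) <|
  pop .wordV (fun r o => { r with bv := o.getD false }) <|
  pop .wordW (fun r o => { r with bw := o.getD false }) q

/-- Push the last bits popped, as values of a node of the first block. -/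
def pushRow (k : Stk) (hk : k.Sym = Wire) (q : Code) : Code :=
  push k (fun r => cast hk.symm (rowWire r.bu r.bv r.bw)) q

/-- Push the last bits popped, as values of a node of the second block. -/
def pushCol (k : Stk) (hk : k.Sym = Wire) (q : Code) : Code :=
  push k (fun r => cast hk.symm (colWire r.bu r.bv r.bw)) q

/-- Push the bits of a block onto the stacks holding the input nodes of the two circuits. The
second circuit has the blocks `I`, `B` as inputs if `hint = false`, and `B`, `O` otherwise. -/
def pushBlk (hint : Bool) (j : Blk) (q : Code) : Code :=
  match hint, j with
  | false, .I => pushRow .wires rfl <| pushRow .left rfl q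
  | false, .O => pushCol .wires rfl q
  | false, .B => pushCol .right rfl q
  | true, .I => pushRow .wires rfl q
  | true, .O => pushCol .wires rfl <| pushCol .right rfl q
  | true, .B => pushRow .left rfl q

/-- The label following the reading of a block. -/
def Blk.next : Blk → Lab
  | .I => .rd .O
  | .O => .rd .B
  | .B => .gate none

/-- The label following the evaluation of a circuit to the value `val`. -/
def afterOutput (acc : Wire → Wire → Bool) (m : Option Wire) (val : Wire) : Lab :=
  match m with
  | none => .clr val
  | some r => .chk (acc r val)

/-- The program of the machine. -/
def prog (hint : Bool) (acc : Wire → Wire → Bool) : Lab → Code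
  | .split =>
    pop .inp (fun r o => { r with sym := o }) <|
    branch (fun r => r.sym.isNone) (goto fun _ => .rev) <|
    branch (fun r => r.sym.any (·.isLeft))
      (push .rev (fun r => match r.sym with | some (.inl b) => b | _ => false) <|
        goto fun _ => .split) <|
    branch (fun r => match r.sym with | some (.inr (.inl _)) => true | _ => false)
      (push .wordU (fun r => match r.sym with | some (.inr (.inl b)) => b | _ => false) <|
        goto fun _ => .split) <|
    branch (fun r => match r.sym with | some (.inr (.inr (.inl _))) => true | _ => false)
      (push .wordV (fun r => match r.sym with | some (.inr (.inr (.inl b))) => b | _ => false) <|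
        goto fun _ => .split)
      (push .wordW (fun r => match r.sym with | some (.inr (.inr (.inr b))) => b | _ => false) <|
        goto fun _ => .split)
  | .rev =>
    pop .rev (fun r o => { r with b := o }) <|
    branch (fun r => r.b.isSome)
      (push .code (fun r => r.b.getD false) <| goto fun _ => .rev)
      (goto fun _ => .rd .I)
  | .rd j =>
    pop .code (fun r o => { r with b := o }) <|
    branch (fun r => r.b.getD false)
      (popWord <| pushBlk hint j <| goto fun _ => .rd j)
      (goto fun r => if r.b.isSome then j.next else .clean false)
  | .gate m =>
    pop .code (fun r o => { r with b := o }) <|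
    branch (fun r => r.b.getD false)
      (pop .code (fun r o => { r with b₁ := o }) <|
        pop .code (fun r o => { r with b₂ := o }) <|
        branch (fun r => r.b₁ == some false && r.b₂ == some false)
          (pop .code (fun r o => { r with b := o }) <|
            branch (fun r => r.b.isSome)
              (push .wires (fun r _ _ => r.b.getD false) <| goto fun _ => .gate m)
              (goto fun _ => .clean false))
          (goto fun r => match r.b₁, r.b₂ with
            | some false, some true => .mv m .not
            | some true, some isOr => .mv m (.bin isOr)
            | _, _ => .clean false))
      (goto fun r => if r.b.isSome then .mv m .out else .clean false)
  | .mv m op =>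
    pop .wires (fun r o => { r with y := o }) <|
    branch (fun r => r.y.isSome)
      (push .temp (fun r => r.y.getD default) <| goto fun _ => .mv m op)
      (goto fun _ => .idx m op)
  | .idx m op =>
    pop .code (fun r o => { r with b := o }) <|
    branch (fun r => r.b.getD false)
      (pop .temp (fun r o => { r with y := o }) <|
        branch (fun r => r.y.isSome)
          (push .wires (fun r => r.y.getD default) <| goto fun _ => .idx m op)
          (goto fun _ => .clean false))
      -- The wire found is only inspected and stays on the stack, so that moving everything back
      -- restores the wires.
      (peek .temp (fun r o => { r with y := o }) <|
        goto fun r => match r.b, r.y with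
          | some _, some a => .back m op a
          | _, _ => .clean false)
  | .back m op val =>
    pop .temp (fun r o => { r with y := o }) <|
    branch (fun r => r.y.isSome)
      (push .wires (fun r => r.y.getD default) <| goto fun _ => .back m op val)
      (match op with
        | .out => goto fun _ => afterOutput acc m val
        | .not => push .wires (fun _ p q => !(val p q)) <| goto fun _ => .gate m
        | .bin isOr => goto fun _ => .mv m (.bin' isOr val)
        | .bin' isOr arg =>
          push .wires (fun _ p q => if isOr then arg p q || val p q else arg p q && val p q) <|
          goto fun _ => .gate m)
  | .clr r =>
    pop .wires (fun r o => { r with y := o }) <|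
    goto fun t => if t.y.isSome then .clr r else .left r
  | .left r =>
    pop .left (fun r o => { r with y := o }) <|
    branch (fun r => r.y.isSome)
      (push .temp (fun r => r.y.getD default) <| goto fun _ => .left r)
      (goto fun _ => .left' r)
  | .left' r =>
    pop .temp (fun r o => { r with y := o }) <|
    branch (fun r => r.y.isSome)
      (push .wires (fun r => r.y.getD default) <| goto fun _ => .left' r)
      (goto fun _ => .right r)
  | .right r =>
    pop .right (fun r o => { r with y := o }) <|
    branch (fun r => r.y.isSome)
      (push .temp (fun r => r.y.getD default) <| goto fun _ => .right r)
      (goto fun _ => .right' r)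
  | .right' r =>
    pop .temp (fun r o => { r with y := o }) <|
    branch (fun r => r.y.isSome)
      (push .wires (fun r => r.y.getD default) <| goto fun _ => .right' r)
      (goto fun _ => .gate (some r))
  | .chk res =>
    peek .code (fun r o => { r with b := o }) <|
    goto fun r => .clean (r.b.isNone && res)
  | .clean res =>
    -- With the state reset, `bu` records whether this pass popped a symbol from any stack; if none
    -- did, all stacks are empty.
    load (fun _ => {}) <|
    [Stk.inp, .rev, .code, .wordU, .wordV, .wordW, .wires, .temp, .left, .right].foldr
      (fun k q => pop k (fun r o => { r with bu := r.bu || o.isSome }) q) <|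
    branch (fun r => r.bu)
      (goto fun _ => .clean res)
      (push .code (fun _ => res) <| load (fun _ => {}) halt)

end Program

/-- The machine. -/
noncomputable def machine (hint : Bool) (acc : Wire → Wire → Bool) : FinTM2 :=
  letI := Fintype.ofFinite Lab
  letI := Fintype.ofFinite Reg
  { K := Stk
    k₀ := .inp
    k₁ := .code
    Γ := Stk.Sym
    Λ := Lab
    main := .split
    σ := Reg
    initialState := {}
    Γk₀Fin := inferInstanceAs (Fintype Quad)
    m := prog hint acc }

/-! ### Reachability -/

section Reach
variable {hint : Bool} {acc : Wire → Wire → Bool}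

/-- From the label `l` and the stacks `s`, the machine reaches the label `l'` and the stacks `s'`
in at most `t` steps, whatever its internal state is. -/
def Reach (hint : Bool) (acc : Wire → Wire → Bool) (t : ℕ) (l : Lab) (s : Store) (l' : Lab)
    (s' : Store) : Prop :=
  ∀ v : Reg, ∃ n ≤ t, ∃ v' : Reg,
    (flip bind (TM2.step (prog hint acc)))^[n] (some ⟨some l, v, s.stk⟩) =
      some ⟨some l', v', s'.stk⟩

theorem Reach.refl (t : ℕ) (l : Lab) (s : Store) : Reach hint acc t l s l s :=
  fun v => ⟨0, Nat.zero_le _, v, rfl⟩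

theorem Reach.trans {t t' : ℕ} {l l' l'' : Lab} {s s' s'' : Store}
    (h : Reach hint acc t l s l' s') (h' : Reach hint acc t' l' s' l'' s'') :
    Reach hint acc (t + t') l s l'' s'' := by
  intro v
  obtain ⟨n, hn, v', e⟩ := h v
  obtain ⟨n', hn', v'', e'⟩ := h' v'
  exact ⟨n' + n, by omega, v'', by rw [Function.iterate_add_apply, e, e']⟩

theorem Reach.mono {t t' : ℕ} {l l' : Lab} {s s' : Store}
    (h : Reach hint acc t l s l' s') (ht : t ≤ t') : Reach hint acc t' l s l' s' := by
  intro v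
  obtain ⟨n, hn, r⟩ := h v
  exact ⟨n, hn.trans ht, r⟩

/-- The successor may not depend on the state `v`. This is what lets runs be composed without
tracking the state. -/
theorem Reach.step {l l' : Lab} {s s' : Store}
    (h : ∀ v, (TM2.stepAux (prog hint acc l) v s.stk).l = some l' ∧
      (TM2.stepAux (prog hint acc l) v s.stk).stk = s'.stk) :
    Reach hint acc 1 l s l' s' := by
  intro v
  refine ⟨1, le_rfl, (TM2.stepAux (prog hint acc l) v s.stk).var, ?_⟩
  obtain ⟨h1, h2⟩ := h v
  rw [← h1, ← h2]
  rfl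

/-- Prepend a single step. -/
theorem Reach.head {t : ℕ} {l l' l'' : Lab} {s s' s'' : Store}
    (h : ∀ v, (TM2.stepAux (prog hint acc l) v s.stk).l = some l' ∧
      (TM2.stepAux (prog hint acc l) v s.stk).stk = s'.stk)
    (h' : Reach hint acc t l' s' l'' s'') : Reach hint acc (t + 1) l s l'' s'' :=
  ((Reach.step h).trans h').mono (by omega)

end Reach

/-! ### The size of the stacks -/

section Size
variable {hint : Bool} {acc : Wire → Wire → Bool}

/-- The total size of the stacks. -/
def stackSize (S : ∀ k : Stk, List k.Sym) : ℕ := ∑ k, (S k).length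

/-- The maximal number of symbols pushed by a statement. -/
def pushes : Code → ℕ
  | .push _ _ q => pushes q + 1
  | .peek _ _ q => pushes q
  | .pop _ _ q => pushes q
  | .load _ q => pushes q
  | .branch _ q q' => max (pushes q) (pushes q')
  | .goto _ => 0
  | .halt => 0

theorem stackSize_tail_lt (S : ∀ k : Stk, List k.Sym) (h : stackSize S ≠ 0) :
    stackSize (fun k => (S k).tail) < stackSize S := by
  obtain ⟨k, hk, hk'⟩ := Finset.exists_ne_zero_of_sum_ne_zero h
  refine Finset.sum_lt_sum (fun k _ => by simp) ⟨k, hk, ?_⟩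
  simp only [List.length_tail]
  omega

/-- The additive form avoids subtraction of natural numbers. -/
theorem stackSize_update (S : ∀ k : Stk, List k.Sym) (k : Stk) (l : List k.Sym) :
    stackSize (Function.update S k l) + (S k).length = stackSize S + l.length := by
  unfold stackSize
  rw [← Finset.add_sum_erase _ _ (Finset.mem_univ k),
    ← Finset.add_sum_erase (a := k) _ (fun k => (S k).length) (Finset.mem_univ k),
    Finset.sum_congr rfl (g := fun k => (S k).length)]
  · simp; omega
  · intro x hx
    rw [Function.update_of_ne (Finset.ne_of_mem_erase hx)]

theorem stackSize_stepAux (q : Code) (v : Reg) (S : ∀ k : Stk, List k.Sym) :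
    stackSize (TM2.stepAux q v S).stk ≤ stackSize S + pushes q := by
  induction q generalizing v S with
  | push k f q ih =>
    have := ih v (Function.update S k (f v :: S k))
    have h2 := stackSize_update S k (f v :: S k)
    simp only [TM2.stepAux, pushes, List.length_cons] at *
    omega
  | peek k f q ih => exact ih _ _
  | pop k f q ih =>
    have := ih (f v (S k).head?) (Function.update S k (S k).tail)
    have h2 := stackSize_update S k (S k).tail
    simp only [TM2.stepAux, pushes, List.length_tail] at *
    omega
  | load f q ih => exact ih _ _
  | branch p q q' ih ih' =>
    have h1 := ih v S
    have h2 := ih' v S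
    simp only [TM2.stepAux, pushes]
    cases p v <;> simp <;> omega
  | goto f => simp [TM2.stepAux, pushes]
  | halt => simp [TM2.stepAux, pushes]

/-- Two pushes occur only when reading a block that feeds both circuits. -/
theorem pushes_prog_le (l : Lab) : pushes (prog hint acc l) ≤ 2 := by
  cases l with
  | rd j => cases hint <;> cases j <;> simp [prog, pushes, popWord, pushBlk, pushRow, pushCol]
  | back m op val => cases op <;> simp [prog, pushes]
  | _ => simp [prog, pushes]

theorem stackSize_iterate (n : ℕ) (c c' : TM2.Cfg Stk.Sym Lab Reg)
    (h : (flip bind (TM2.step (prog hint acc)))^[n] (some c) = some c') :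
    stackSize c'.stk ≤ stackSize c.stk + 2 * n := by
  induction n generalizing c with
  | zero => obtain rfl : c = c' := by simpa using h
            simp
  | succ n ih =>
    rw [Function.iterate_succ_apply] at h
    obtain ⟨_ | l, v, S⟩ := c
    -- A halted configuration has no successor, so it cannot lead to `c'` in a positive number of
    -- steps.
    · have : ∀ n, (flip bind (TM2.step (prog hint acc)))^[n] none = none := by
        intro n
        induction n with
        | zero => rfl
        | succ n ih => rw [Function.iterate_succ_apply]; exact ih
      have h' : (flip bind (TM2.step (prog hint acc)))^[n] none = some c' := h
      rw [this] at h'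
      cases h'
    · have h1 := ih _ h
      have h2 := stackSize_stepAux (prog hint acc l) v S
      have h3 := pushes_prog_le (hint := hint) (acc := acc) l
      simp only at *
      omega

end Size

/-! ### Halting -/

section Halt
variable {hint : Bool} {acc : Wire → Wire → Bool}

theorem stackSize_stk (s : Store) : stackSize s.stk = s.inp.length + s.rev.length +
    s.code.length + s.wordU.length + s.wordV.length + s.wordW.length + s.wires.length +
    s.temp.length + s.left.length + s.right.length := by
  have : (Finset.univ : Finset Stk) =
    {.inp, .rev, .code, .wordU, .wordV, .wordW, .wires, .temp, .left, .right} := rfl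
  simp [stackSize, this]
  omega

/-- Each pass takes the top off every nonempty stack, so the total size drops strictly until one
last pass finds everything empty and writes the result. -/
theorem clean_halts (res : Bool) (v : Reg) (s : Store) :
    ∃ n ≤ stackSize s.stk + 1,
      (flip bind (TM2.step (prog hint acc)))^[n] (some ⟨some (.clean res), v, s.stk⟩) =
        some ⟨none, {}, ({ code := [res] } : Store).stk⟩ := by
  induction hN : stackSize s.stk using Nat.strong_induction_on generalizing v s with
  | _ N ih =>
  have key : ∃ v', (stackSize s.stk = 0 ∧ TM2.stepAux (prog hint acc (.clean res)) v s.stk =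
      ⟨none, {}, ({ code := [res] } : Store).stk⟩) ∨
      ∃ s' : Store, stackSize s'.stk < stackSize s.stk ∧
      TM2.stepAux (prog hint acc (.clean res)) v s.stk = ⟨some (.clean res), v', s'.stk⟩ := by
    by_cases h : stackSize s.stk = 0
    · refine ⟨{}, .inl ⟨h, ?_⟩⟩
      rw [stackSize_stk] at h
      obtain ⟨a, b, c, d, e, f, g, h', i, j⟩ := s
      simp only [Nat.add_eq_zero_iff, List.length_eq_zero_iff] at h
      obtain ⟨⟨⟨⟨⟨⟨⟨⟨⟨rfl, rfl⟩, rfl⟩, rfl⟩, rfl⟩, rfl⟩, rfl⟩, rfl⟩, rfl⟩, rfl⟩ := h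
      simp [prog]
    · have e : (fun k => (s.stk k).tail) = (⟨s.inp.tail, s.rev.tail, s.code.tail, s.wordU.tail,
          s.wordV.tail, s.wordW.tail, s.wires.tail, s.temp.tail, s.left.tail,
          s.right.tail⟩ : Store).stk := by
        funext k; cases k <;> rfl
      refine ⟨{ bu := true }, .inr ⟨⟨s.inp.tail, s.rev.tail, s.code.tail, s.wordU.tail,
        s.wordV.tail, s.wordW.tail, s.wires.tail, s.temp.tail, s.left.tail, s.right.tail⟩,
        ?_, ?_⟩⟩
      · rw [← e]
        exact stackSize_tail_lt s.stk h
      · have hb : (s.inp.head?.isSome || s.rev.head?.isSome || s.code.head?.isSome ||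
            s.wordU.head?.isSome || s.wordV.head?.isSome || s.wordW.head?.isSome ||
            s.wires.head?.isSome || s.temp.head?.isSome || s.left.head?.isSome ||
            s.right.head?.isSome) = true := by
          by_contra hb
          apply h
          rw [stackSize_stk]
          simp at hb
          simp [hb]
        simp [prog, hb]
  obtain ⟨v', ⟨h0, h⟩ | ⟨s', hs, h⟩⟩ := key
  · exact ⟨1, by omega, congrArg some h⟩
  · obtain ⟨n, hn, e⟩ := ih _ (hN ▸ hs) v' s' rfl
    refine ⟨n + 1, by omega, ?_⟩
    rw [Function.iterate_succ_apply, ← e]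
    exact congrArg _ (congrArg some h)

/-- A run ending in a `clean` label can be completed to a halting run. -/
theorem Reach.halts {t : ℕ} {l : Lab} {s s' : Store} {res : Bool}
    (h : Reach hint acc t l s (.clean res) s') (v : Reg) :
    ∃ n ≤ 3 * t + stackSize s.stk + 1,
      (flip bind (TM2.step (prog hint acc)))^[n] (some ⟨some l, v, s.stk⟩) =
        some ⟨none, {}, ({ code := [res] } : Store).stk⟩ := by
  obtain ⟨n, hn, v', e⟩ := h v
  obtain ⟨n', hn', e'⟩ := clean_halts (hint := hint) (acc := acc) res v' s'
  -- At most `t` steps add at most `2 * t` symbols, and cleaning costs one step per symbol: hence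
  -- the factor 3.
  have := stackSize_iterate _ _ _ e
  refine ⟨n' + n, by simp only at this; omega, ?_⟩
  rw [Function.iterate_add_apply, e, e']

end Halt

/-! ### The phases of the machine -/

section Phases
variable {hint : Bool} {acc : Wire → Wire → Bool}

/-- The machine reaches the label `clean false` in at most `t` steps. -/
def Fails (hint : Bool) (acc : Wire → Wire → Bool) (t : ℕ) (l : Lab) (s : Store) : Prop :=
  ∃ s', Reach hint acc t l s (.clean false) s'

theorem Reach.fails {t t' t'' : ℕ} {l l' : Lab} {s s' : Store} (h : Reach hint acc t l s l' s')
    (h' : Fails hint acc t' l' s') (ht : t + t' ≤ t'') : Fails hint acc t'' l s :=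
  h'.imp fun _ r => (h.trans r).mono ht

theorem Fails.step {l : Lab} {s s' : Store} {t : ℕ}
    (h : ∀ v, (TM2.stepAux (prog hint acc l) v s.stk).l = some (.clean false) ∧
      (TM2.stepAux (prog hint acc l) v s.stk).stk = s'.stk) :
    Fails hint acc (t + 1) l s :=
  ⟨s', (Reach.step h).mono (by omega)⟩

/-! ### Distributing the marked input -/

/-- Pushing letter by letter reverses a word. For `x` this is undone afterwards; the three
quantified words stay reversed, which is harmless under quantification. -/
theorem reach_split_x (x : List Bool) (l : List Quad) (s : Store) :
    Reach hint acc x.length .split { s with inp := x.map .inl ++ l }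
      .split { s with inp := l, rev := x.reverse ++ s.rev } := by
  induction x generalizing s with
  | nil => exact Reach.refl _ _ _
  | cons b x ih =>
    refine Reach.head (l' := .split) (s' := { s with inp := x.map .inl ++ l, rev := b :: s.rev })
      (by simp [prog]) ?_
    simpa using ih { s with rev := b :: s.rev }

theorem reach_split_u (x : List Bool) (l : List Quad) (s : Store) :
    Reach hint acc x.length .split { s with inp := x.map (.inr ∘ .inl) ++ l }
      .split { s with inp := l, wordU := x.reverse ++ s.wordU } := by
  induction x generalizing s with
  | nil => exact Reach.refl _ _ _
  | cons b x ih =>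
    refine Reach.head (l' := .split) (s' := { s with inp := x.map (.inr ∘ .inl) ++ l, wordU := b :: s.wordU })
      (by simp [prog]) ?_
    simpa using ih { s with wordU := b :: s.wordU }

theorem reach_split_v (x : List Bool) (l : List Quad) (s : Store) :
    Reach hint acc x.length .split { s with inp := x.map (.inr ∘ .inr ∘ .inl) ++ l }
      .split { s with inp := l, wordV := x.reverse ++ s.wordV } := by
  induction x generalizing s with
  | nil => exact Reach.refl _ _ _
  | cons b x ih =>
    refine Reach.head (l' := .split)
      (s' := { s with inp := x.map (.inr ∘ .inr ∘ .inl) ++ l, wordV := b :: s.wordV })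
      (by simp [prog]) ?_
    simpa using ih { s with wordV := b :: s.wordV }

theorem reach_split_w (x : List Bool) (l : List Quad) (s : Store) :
    Reach hint acc x.length .split { s with inp := x.map (.inr ∘ .inr ∘ .inr) ++ l }
      .split { s with inp := l, wordW := x.reverse ++ s.wordW } := by
  induction x generalizing s with
  | nil => exact Reach.refl _ _ _
  | cons b x ih =>
    refine Reach.head (l' := .split)
      (s' := { s with inp := x.map (.inr ∘ .inr ∘ .inr) ++ l, wordW := b :: s.wordW })
      (by simp [prog]) ?_
    simpa using ih { s with wordW := b :: s.wordW }

theorem reach_rev (x : List Bool) (s : Store) :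
    Reach hint acc (x.length + 1) .rev { s with rev := x }
      (.rd .I) { s with rev := [], code := x.reverse ++ s.code } := by
  induction x generalizing s with
  | nil => exact Reach.step (by simp [prog])
  | cons b x ih =>
    refine Reach.head (l' := .rev) (s' := { s with rev := x, code := b :: s.code }) (by simp [prog]) ?_
    simpa using ih { s with code := b :: s.code }

/-- From the initial stacks, the machine distributes its input. -/
theorem reach_input (x u v w : List Bool) :
    Reach hint acc (2 * x.length + u.length + v.length + w.length + 2) .split
      { inp := quadEncoding.encode (x, u, v, w) } (.rd .I)
      { code := x, wordU := u.reverse, wordV := v.reverse, wordW := w.reverse } := by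
  have h1 := reach_split_x (hint := hint) (acc := acc) x
    (u.map (.inr ∘ .inl) ++ (v.map (.inr ∘ .inr ∘ .inl) ++ w.map (.inr ∘ .inr ∘ .inr))) {}
  have h2 := reach_split_u (hint := hint) (acc := acc) u
    (v.map (.inr ∘ .inr ∘ .inl) ++ w.map (.inr ∘ .inr ∘ .inr)) { rev := x.reverse }
  have h3 := reach_split_v (hint := hint) (acc := acc) v (w.map (.inr ∘ .inr ∘ .inr))
    { rev := x.reverse, wordU := u.reverse }
  have h4 := reach_split_w (hint := hint) (acc := acc) w []
    { rev := x.reverse, wordU := u.reverse, wordV := v.reverse }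
  have h5 : Reach hint acc 1 .split
    { rev := x.reverse, wordU := u.reverse, wordV := v.reverse, wordW := w.reverse } .rev
    { rev := x.reverse, wordU := u.reverse, wordV := v.reverse, wordW := w.reverse } :=
    Reach.step (by simp [prog])
  have h6 := reach_rev (hint := hint) (acc := acc) x.reverse
    { wordU := u.reverse, wordV := v.reverse, wordW := w.reverse }
  simp only [List.append_nil, List.reverse_reverse, List.length_reverse] at h1 h2 h3 h4 h6
  have e : quadEncoding.encode (x, u, v, w) = x.map .inl ++ (u.map (.inr ∘ .inl) ++
      (v.map (.inr ∘ .inr ∘ .inl) ++ w.map (.inr ∘ .inr ∘ .inr))) := by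
    simp [quadEncoding, Computability.encodingProd, Computability.encodingList,
      Function.comp_def]
  rw [e]
  exact (h1.trans (h2.trans (h3.trans (h4.trans (h5.trans h6))))).mono (by omega)

/-! ### Reading the dimensions -/

/-- The bit of a word at a position, `false` if there is none. -/
def bit (l : List Bool) (i : ℕ) : Bool := l[i]?.getD false

@[simp] theorem bit_tail (l : List Bool) (i : ℕ) : bit l.tail i = bit l (i + 1) := by
  simp [bit]

@[simp] theorem bit_drop (l : List Bool) (k i : ℕ) : bit (l.drop k) i = bit l (k + i) := by
  simp [bit]

theorem head?_getD_eq_bit (l : List Bool) : l.head?.getD false = bit l 0 := by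
  simp [bit, List.head?_eq_getElem?]

/-- The wires for the next `n` bits of the three words, read as a first block. -/
def rows (s : Store) (n : ℕ) : List Wire :=
  List.ofFn fun i : Fin n => rowWire (bit s.wordU i) (bit s.wordV i) (bit s.wordW i)

/-- The wires for the next `n` bits of the three words, read as a second block. -/
def cols (s : Store) (n : ℕ) : List Wire :=
  List.ofFn fun i : Fin n => colWire (bit s.wordU i) (bit s.wordV i) (bit s.wordW i)

/-- The stacks after the dimension `n` of a block has been read, the code remaining being `y`. -/
def addBlk (hint : Bool) (j : Blk) (n : ℕ) (s : Store) (y : List Bool) : Store :=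
  { s with
    code := y
    wordU := s.wordU.drop n
    wordV := s.wordV.drop n
    wordW := s.wordW.drop n
    wires :=
      (if j = .I then (rows s n).reverse else if j = .O then (cols s n).reverse else []) ++ s.wires
    left := (if j = bif hint then .B else .I then (rows s n).reverse else []) ++ s.left
    right := (if j = bif hint then .O else .B then (cols s n).reverse else []) ++ s.right }

theorem addBlk_zero (j : Blk) (s : Store) (y : List Bool) :
    addBlk hint j 0 s y = { s with code := y } := by
  cases hint <;> cases j <;> simp [addBlk, rows, cols]

theorem rows_succ (s : Store) (n : ℕ) (s' : Store) (hu : s'.wordU = s.wordU.tail)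
    (hv : s'.wordV = s.wordV.tail) (hw : s'.wordW = s.wordW.tail) :
    rows s (n + 1) = rowWire (bit s.wordU 0) (bit s.wordV 0) (bit s.wordW 0) :: rows s' n := by
  simp [rows, List.ofFn_succ, hu, hv, hw]

theorem cols_succ (s : Store) (n : ℕ) (s' : Store) (hu : s'.wordU = s.wordU.tail)
    (hv : s'.wordV = s.wordV.tail) (hw : s'.wordW = s.wordW.tail) :
    cols s (n + 1) = colWire (bit s.wordU 0) (bit s.wordV 0) (bit s.wordW 0) :: cols s' n := by
  simp [cols, List.ofFn_succ, hu, hv, hw]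

theorem addBlk_succ (j : Blk) (n : ℕ) (s : Store) (y z : List Bool) :
    addBlk hint j n (addBlk hint j 1 s z) y = addBlk hint j (n + 1) s y := by
  have e := rows_succ s n (addBlk hint j 1 s z) (by simp [addBlk]) (by simp [addBlk])
    (by simp [addBlk])
  have e' := cols_succ s n (addBlk hint j 1 s z) (by simp [addBlk]) (by simp [addBlk])
    (by simp [addBlk])
  cases hint <;> cases j <;> simp [addBlk, e, e'] <;> simp [rows, cols]

theorem codeNat_zero_append (y : List Bool) : codeNat 0 ++ y = false :: y := rfl

theorem codeNat_succ_append (n : ℕ) (y : List Bool) :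
    codeNat (n + 1) ++ y = true :: (codeNat n ++ y) := rfl

theorem nil_ne_codeNat (n : ℕ) (y : List Bool) : [] ≠ codeNat n ++ y := by
  simp [codeNat]

/-- This dichotomy is the pattern for all parsing phases: either the code has the expected prefix
and the machine consumes it, or it has none and the machine rejects. The negative half is needed to
know that rejected words code no instance. -/
theorem rd_spec (j : Blk) (s : Store) :
    (∃ n y, s.code = codeNat n ++ y ∧
      Reach hint acc (s.code.length + 1) (.rd j) s j.next (addBlk hint j n s y)) ∨
    (∀ n y, s.code ≠ codeNat n ++ y) ∧ Fails hint acc (s.code.length + 1) (.rd j) s := by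
  obtain ⟨x, hx⟩ : ∃ x, s.code = x := ⟨_, rfl⟩
  rw [hx]
  induction x generalizing s with
  | nil =>
    exact .inr ⟨nil_ne_codeNat, Fails.step (s' := s) (by cases s; subst hx; simp [prog])⟩
  | cons b x ih =>
    cases b with
    | false =>
      refine .inl ⟨0, x, rfl, ?_⟩
      rw [addBlk_zero]
      exact (Reach.step (by simp [prog, hx])).mono (by omega)
    | true =>
      -- One unary mark acts as a block of length one; `addBlk_succ` merges it with the rest.
      have step : Reach hint acc 1 (.rd j) s (.rd j) (addBlk hint j 1 s x) := by
        refine Reach.step fun v => ?_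
        cases hint <;> cases j <;>
          simp [prog, hx, popWord, pushBlk, pushRow, pushCol, addBlk, rows, cols,
            head?_getD_eq_bit]
      obtain ⟨n, y, e, r⟩ | ⟨h, f⟩ := ih (addBlk hint j 1 s x) rfl
      · refine .inl ⟨n + 1, y, by rw [e, codeNat_succ_append], ?_⟩
        rw [addBlk_succ] at r
        exact (step.trans r).mono (by simp; omega)
      · refine .inr ⟨fun n y e => ?_, step.fails f (by simp; omega)⟩
        cases n with
        | zero => simp [codeNat_zero_append] at e
        | succ n => exact h n y (by simpa [codeNat_succ_append] using e)

end Phases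

/-! ### Looking up a wire by its unary index -/

section Lookup
variable {hint : Bool} {acc : Wire → Wire → Bool}

theorem reach_mv (m : Option Wire) (op : Op) (W : List Wire) (s : Store) :
    Reach hint acc (W.length + 1) (.mv m op) { s with wires := W }
      (.idx m op) { s with wires := [], temp := W.reverse ++ s.temp } := by
  induction W generalizing s with
  | nil => exact Reach.step (by simp [prog])
  | cons a W ih =>
    refine Reach.head (l' := .mv m op) (s' := { s with wires := W, temp := a :: s.temp })
      (by simp [prog]) ?_
    simpa using ih { s with temp := a :: s.temp }

theorem reach_back (m : Option Wire) (op : Op) (val : Wire) (T : List Wire) (s : Store) :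
    Reach hint acc T.length (.back m op val) { s with temp := T }
      (.back m op val) { s with temp := [], wires := T.reverse ++ s.wires } := by
  induction T generalizing s with
  | nil => exact Reach.refl _ _ _
  | cons a T ih =>
    refine Reach.head (l' := .back m op val) (s' := { s with temp := T, wires := a :: s.wires })
      (by simp [prog]) ?_
    simpa using ih { s with wires := a :: s.wires }

/-- Every mark of the index moves one wire away, so its end finds wire `i` on top. Failure covers
both a truncated code and an index beyond the available wires. -/
theorem idx_spec (m : Option Wire) (op : Op) (x : List Bool) (T : List Wire) (s : Store) :
    (∃ i y a, T[i]? = some a ∧ x = codeNat i ++ y ∧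
      Reach hint acc (i + 1) (.idx m op) { s with code := x, temp := T } (.back m op a)
        { s with code := y, temp := T.drop i, wires := (T.take i).reverse ++ s.wires }) ∨
    (∀ i < T.length, ∀ y, x ≠ codeNat i ++ y) ∧
      Fails hint acc (x.length + 1) (.idx m op) { s with code := x, temp := T } := by
  induction x generalizing T s with
  | nil =>
    refine .inr ⟨fun i _ => nil_ne_codeNat i, Fails.step (s' := { s with code := [], temp := T })
      (by simp [prog])⟩
  | cons b x ih =>
    cases b with
    | false =>
      cases T with
      | nil =>
        exact .inr ⟨fun i hi => absurd hi (by simp),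
          Fails.step (s' := { s with code := x, temp := [] }) (by simp [prog])⟩
      | cons a T =>
        exact .inl ⟨0, x, a, rfl, rfl, Reach.step (by simp [prog])⟩
    | true =>
      cases T with
      | nil =>
        exact .inr ⟨fun i hi => absurd hi (by simp),
          Fails.step (s' := { s with code := x, temp := [] }) (by simp [prog])⟩
      | cons a T =>
        have step : Reach hint acc 1 (.idx m op) { s with code := true :: x, temp := a :: T }
            (.idx m op) { s with code := x, temp := T, wires := a :: s.wires } :=
          Reach.step (by simp [prog])
        obtain ⟨i, y, a', h, e, r⟩ | ⟨h, f⟩ := ih T { s with wires := a :: s.wires }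
        · refine .inl ⟨i + 1, y, a', by simpa using h, by rw [e, codeNat_succ_append], ?_⟩
          exact (step.trans (by simpa using r)).mono (by omega)
        · refine .inr ⟨fun i hi y e => ?_, step.fails f (by simp; omega)⟩
          cases i with
          | zero => simp [codeNat_zero_append] at e
          | succ i => exact h i (by simpa using hi) y (by simpa [codeNat_succ_append] using e)

/-- The newest wire is on top of `wires`, so moving all of them to `temp` brings wire 0 to the top.
A successful lookup costs (n + 1) + (i + 1) + (n - i) = 2n + 2 steps and leaves the wires as they
were. -/
theorem lookup_spec (m : Option Wire) (op : Op) {n : ℕ} (f : Fin n → Wire) (x : List Bool)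
    (s : Store) {t : ℕ} (hn : n ≤ t) (hx : x.length ≤ t) :
    (∃ (i : Fin n) (y : List Bool), x = codeNat i ++ y ∧
      Reach hint acc (2 * t + 2) (.mv m op)
        { s with code := x, temp := [], wires := (List.ofFn f).reverse } (.back m op (f i))
        { s with code := y, temp := [], wires := (List.ofFn f).reverse }) ∨
    (∀ (i : Fin n) (y : List Bool), x ≠ codeNat i ++ y) ∧
      Fails hint acc (2 * t + 2) (.mv m op)
        { s with code := x, temp := [], wires := (List.ofFn f).reverse } := by
  have h1 := reach_mv (hint := hint) (acc := acc) m op (List.ofFn f).reverse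
    { s with code := x, temp := [] }
  simp only [List.length_reverse, List.length_ofFn, List.reverse_reverse, List.append_nil] at h1
  obtain ⟨i, y, a, hi, e, r⟩ | ⟨h, r⟩ := idx_spec (hint := hint) (acc := acc) m op x (List.ofFn f)
    { s with wires := [] }
  · obtain ⟨hin, hi⟩ := List.getElem?_eq_some_iff.1 hi
    have hin' : i < n := by simpa using hin
    refine .inl ⟨⟨i, hin'⟩, y, e, ?_⟩
    have h2 := reach_back (hint := hint) (acc := acc) m op a ((List.ofFn f).drop i)
      { s with code := y, wires := ((List.ofFn f).take i).reverse }
    simp only [List.append_nil] at r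
    rw [← List.reverse_append, List.take_append_drop] at h2
    have ha : f ⟨i, hin'⟩ = a := by rw [← hi]; simp
    rw [ha]
    exact ((h1.trans r).trans h2).mono (by simp; omega)
  · refine .inr ⟨fun i y => h i (by simp) y, h1.fails r (by omega)⟩

end Lookup

/-! ### Evaluation of the circuits -/

/-- The values of a gate at the nine evaluation points. -/
def Gate.evalWire {n : ℕ} (g : Gate n) (f : Fin n → Wire) : Wire :=
  fun p q => g.eval fun i => f i p q

/-- The values of a circuit at the nine evaluation points. -/
def Circuit.evalWire {n : ℕ} (c : Circuit n) (f : Fin n → Wire) : Wire :=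
  fun p q => c.eval fun i => f i p q

theorem Circuit.evalWire_gate {n : ℕ} (g : Gate n) (c : Circuit (n + 1)) (f : Fin n → Wire) :
    (Circuit.gate g c).evalWire f =
      c.evalWire (Fin.snoc (α := fun _ => Wire) f (g.evalWire f)) := by
  funext p q
  simp only [Circuit.evalWire, Circuit.eval]
  congr 1
  funext i
  induction i using Fin.lastCases <;> simp [Gate.evalWire]

/-- On the stack, adding a gate is a single push. -/
theorem reverse_ofFn_snoc {n : ℕ} (f : Fin n → Wire) (a : Wire) :
    (List.ofFn (Fin.snoc (α := fun _ => Wire) f a)).reverse = a :: (List.ofFn f).reverse := by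
  rw [List.ofFn_succ']
  simp

theorem codeNat_length (n : ℕ) : (codeNat n).length = n + 1 := by simp [codeNat]

section Eval
variable {hint : Bool} {acc : Wire → Wire → Bool}

/-- The worst case is a binary gate: two lookups of 2t + 2 steps and three single steps. -/
theorem gate_spec (m : Option Wire) {n : ℕ} (f : Fin n → Wire) (x : List Bool)
    (s : Store) {t : ℕ} (hn : n ≤ t) (hx : x.length ≤ t) :
    (∃ (g : Gate n) (y : List Bool), x = g.code ++ y ∧
      Reach hint acc (4 * t + 7) (.gate m)
        { s with code := true :: x, temp := [], wires := (List.ofFn f).reverse } (.gate m)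
        { s with code := y, temp := [], wires := g.evalWire f :: (List.ofFn f).reverse }) ∨
    (∀ (g : Gate n) (y : List Bool), x ≠ g.code ++ y) ∧
      Fails hint acc (4 * t + 7) (.gate m)
        { s with code := true :: x, temp := [], wires := (List.ofFn f).reverse } := by
  match x with
  | [] =>
    refine .inr ⟨fun g y => by cases g <;> simp [Gate.code], ?_⟩
    exact Fails.step (t := 4 * t + 6)
      (s' := { s with code := [], temp := [], wires := (List.ofFn f).reverse }) (by simp [prog])
  | [b] =>
    refine .inr ⟨fun g y => by cases g <;> simp [Gate.code], ?_⟩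
    exact Fails.step (t := 4 * t + 6)
      (s' := { s with code := [], temp := [], wires := (List.ofFn f).reverse })
      (by cases b <;> simp [prog])
  | false :: false :: [] =>
    refine .inr ⟨fun g y => by cases g <;> simp [Gate.code], ?_⟩
    exact Fails.step (t := 4 * t + 6)
      (s' := { s with code := [], temp := [], wires := (List.ofFn f).reverse }) (by simp [prog])
  | false :: false :: b :: y =>
    refine .inl ⟨.const b, y, rfl, ?_⟩
    exact (Reach.step fun v => by simp [prog]; rfl).mono (by omega)
  | false :: true :: x =>
    have step : Reach hint acc 1 (.gate m)
        { s with code := true :: false :: true :: x, temp := [], wires := (List.ofFn f).reverse }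
        (.mv m .not) { s with code := x, temp := [], wires := (List.ofFn f).reverse } :=
      Reach.step (by simp [prog])
    obtain ⟨i, y, e, r⟩ | ⟨h, r⟩ := lookup_spec (hint := hint) (acc := acc) m .not f x s hn
      (by simp at hx; omega)
    · refine .inl ⟨.not i, y, by simp [Gate.code, e], ?_⟩
      refine ((step.trans r).trans (Reach.step (l' := .gate m) fun v => ?_)).mono (by omega)
      simp [prog]
      rfl
    · refine .inr ⟨fun g y e => ?_, step.fails r (by omega)⟩
      cases g <;> simp [Gate.code] at e
      exact h _ _ e
  | true :: isOr :: x =>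
    have step : Reach hint acc 1 (.gate m)
        { s with code := true :: true :: isOr :: x, temp := [], wires := (List.ofFn f).reverse }
        (.mv m (.bin isOr)) { s with code := x, temp := [], wires := (List.ofFn f).reverse } :=
      Reach.step (by simp [prog])
    simp only [List.length_cons] at hx
    obtain ⟨i, z, e, r⟩ | ⟨h, r⟩ := lookup_spec (hint := hint) (acc := acc) m (.bin isOr) f x s hn
      (by omega)
    · have step' : Reach hint acc 1 (.back m (.bin isOr) (f i))
          { s with code := z, temp := [], wires := (List.ofFn f).reverse }
          (.mv m (.bin' isOr (f i)))
          { s with code := z, temp := [], wires := (List.ofFn f).reverse } :=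
        Reach.step (by simp [prog])
      have hz := congrArg List.length e
      rw [List.length_append] at hz
      obtain ⟨j, y, e', r'⟩ | ⟨h', r'⟩ := lookup_spec (hint := hint) (acc := acc) m
        (.bin' isOr (f i)) f z s hn (by omega)
      · cases isOr with
        | false =>
          refine .inl ⟨.and i j, y, by simp [Gate.code, e, e'], ?_⟩
          refine ((((step.trans r).trans step').trans r').trans
            (Reach.step (l' := .gate m) fun v => ?_)).mono (by omega)
          simp [prog]
          rfl
        | true =>
          refine .inl ⟨.or i j, y, by simp [Gate.code, e, e'], ?_⟩
          refine ((((step.trans r).trans step').trans r').trans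
            (Reach.step (l' := .gate m) fun v => ?_)).mono (by omega)
          simp [prog]
          rfl
      · refine .inr ⟨fun g y e'' => ?_, ((step.trans r).trans step').fails r' (by omega)⟩
        cases g <;> simp [Gate.code] at e''
        all_goals
          rw [e] at e''
          -- Unique readability of the first index turns a failed second lookup into the absence of
          -- any gate code.
          exact h' _ _ (codeNat_append_inj e''.2).2
    · refine .inr ⟨fun g y e => ?_, step.fails r (by omega)⟩
      cases g <;> simp [Gate.code] at e
      all_goals exact h _ _ e.2

/-- The quantity "wires plus remaining code" never grows: a gate adds one wire, paid for by its
announcing bit. So the same `t` bounds every lookup, and each of the at most |x| + 1 rounds costs at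
most 4t + 7. The induction is strong because a gate consumes several bits. -/
theorem circuit_spec (m : Option Wire) {n : ℕ} (f : Fin n → Wire) (x : List Bool)
    (s : Store) {t : ℕ} (ht : n + x.length ≤ t) :
    (∃ (c : Circuit n) (y : List Bool) (W : List Wire), x = c.code ++ y ∧ W.length ≤ t ∧
      Reach hint acc ((x.length + 1) * (4 * t + 7)) (.gate m)
        { s with code := x, temp := [], wires := (List.ofFn f).reverse }
        (afterOutput acc m (c.evalWire f)) { s with code := y, temp := [], wires := W }) ∨
    (∀ (c : Circuit n) (y : List Bool), x ≠ c.code ++ y) ∧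
      Fails hint acc ((x.length + 1) * (4 * t + 7)) (.gate m)
        { s with code := x, temp := [], wires := (List.ofFn f).reverse } := by
  induction hN : x.length using Nat.strong_induction_on generalizing n x with
  | _ N ih =>
  have hpos : 4 * t + 7 ≤ (N + 1) * (4 * t + 7) := Nat.le_mul_of_pos_left _ (by omega)
  match x with
  | [] =>
    refine .inr ⟨fun c y => by cases c <;> simp [Circuit.code], ?_⟩
    obtain ⟨s', h⟩ : Fails hint acc (0 + 1) (.gate m)
        { s with code := [], temp := [], wires := (List.ofFn f).reverse } :=
      Fails.step (s' := { s with code := [], temp := [], wires := (List.ofFn f).reverse })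
        (by simp [prog])
    exact ⟨s', h.mono (by omega)⟩
  | false :: x =>
    have step : Reach hint acc 1 (.gate m)
        { s with code := false :: x, temp := [], wires := (List.ofFn f).reverse }
        (.mv m .out) { s with code := x, temp := [], wires := (List.ofFn f).reverse } :=
      Reach.step (by simp [prog])
    simp only [List.length_cons] at ht
    obtain ⟨i, y, e, r⟩ | ⟨h, r⟩ := lookup_spec (hint := hint) (acc := acc) m .out f x s
      (t := t) (by omega) (by omega)
    · refine .inl ⟨.output i, y, (List.ofFn f).reverse, by simp [Circuit.code, e], by simp; omega,
        ?_⟩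
      refine ((step.trans r).trans (Reach.step fun v => ?_)).mono (by omega)
      simp [prog]
      rfl
    · refine .inr ⟨fun c y e => ?_, step.fails r (by omega)⟩
      cases c <;> simp [Circuit.code] at e
      exact h _ _ e
  | true :: x =>
    simp only [List.length_cons] at ht hN
    obtain ⟨g, z, e, r⟩ | ⟨h, r⟩ := gate_spec (hint := hint) (acc := acc) m f x s
      (t := t) (by omega) (by omega)
    · have hz := congrArg List.length e
      rw [List.length_append] at hz
      -- The new stack is again the reversed list of a family of wires, now indexed by `Fin (n +
      -- 1)`.
      rw [← reverse_ofFn_snoc] at r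
      have hle : (z.length + 1) * (4 * t + 7) ≤ N * (4 * t + 7) :=
        Nat.mul_le_mul_right _ (by omega)
      have hN' : (N + 1) * (4 * t + 7) = N * (4 * t + 7) + (4 * t + 7) := by ring
      obtain ⟨c, y, W, e', hW, r'⟩ | ⟨h', r'⟩ := ih z.length (by omega)
        (Fin.snoc (α := fun _ => Wire) f (g.evalWire f)) z (by omega) rfl
      · refine .inl ⟨.gate g c, y, W, by simp [Circuit.code, e, e'], hW, ?_⟩
        rw [Circuit.evalWire_gate]
        exact (r.trans r').mono (by omega)
      · refine .inr ⟨fun c y e'' => ?_, r.fails r' (by omega)⟩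
        cases c with
        | output i => simp [Circuit.code] at e''
        | gate g' c =>
          simp only [Circuit.code, List.cons_append, List.cons.injEq, true_and,
            List.append_assoc] at e''
          rw [e] at e''
          obtain ⟨rfl, e3⟩ := Gate.code_append_inj e''
          exact h' _ _ e3
    · refine .inr ⟨fun c y e => ?_, ?_⟩
      · cases c with
        | output i => simp [Circuit.code] at e
        | gate g' c =>
          simp only [Circuit.code, List.cons_append, List.cons.injEq, true_and,
            List.append_assoc] at e
          exact h _ _ e
      · obtain ⟨s', r⟩ := r
        exact ⟨s', r.mono hpos⟩

end Eval

/-! ### Loading the input nodes of the hint circuit -/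

section Refill
variable {hint : Bool} {acc : Wire → Wire → Bool}

theorem reach_clr (r : Wire) (W : List Wire) (s : Store) :
    Reach hint acc (W.length + 1) (.clr r) { s with wires := W } (.left r)
      { s with wires := [] } := by
  induction W with
  | nil => exact Reach.step (by simp [prog])
  | cons a W ih => exact Reach.head (by simp [prog]) ih

theorem reach_left (r : Wire) (L : List Wire) (s : Store) :
    Reach hint acc (L.length + 1) (.left r) { s with left := L } (.left' r)
      { s with left := [], temp := L.reverse ++ s.temp } := by
  induction L generalizing s with
  | nil => exact Reach.step (by simp [prog])
  | cons a L ih =>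
    refine Reach.head (l' := .left r) (s' := { s with left := L, temp := a :: s.temp })
      (by simp [prog]) ?_
    simpa using ih { s with temp := a :: s.temp }

theorem reach_left' (r : Wire) (T : List Wire) (s : Store) :
    Reach hint acc (T.length + 1) (.left' r) { s with temp := T } (.right r)
      { s with temp := [], wires := T.reverse ++ s.wires } := by
  induction T generalizing s with
  | nil => exact Reach.step (by simp [prog])
  | cons a T ih =>
    refine Reach.head (l' := .left' r) (s' := { s with temp := T, wires := a :: s.wires })
      (by simp [prog]) ?_
    simpa using ih { s with wires := a :: s.wires }

theorem reach_right (r : Wire) (L : List Wire) (s : Store) :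
    Reach hint acc (L.length + 1) (.right r) { s with right := L } (.right' r)
      { s with right := [], temp := L.reverse ++ s.temp } := by
  induction L generalizing s with
  | nil => exact Reach.step (by simp [prog])
  | cons a L ih =>
    refine Reach.head (l' := .right r) (s' := { s with right := L, temp := a :: s.temp })
      (by simp [prog]) ?_
    simpa using ih { s with temp := a :: s.temp }

theorem reach_right' (r : Wire) (T : List Wire) (s : Store) :
    Reach hint acc (T.length + 1) (.right' r) { s with temp := T } (.gate (some r))
      { s with temp := [], wires := T.reverse ++ s.wires } := by
  induction T generalizing s with
  | nil => exact Reach.step (by simp [prog])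
  | cons a T ih =>
    refine Reach.head (l' := .right' r) (s' := { s with temp := T, wires := a :: s.wires })
      (by simp [prog]) ?_
    simpa using ih { s with wires := a :: s.wires }

/-- The wires of the first circuit are replaced by the input nodes of the second one. -/
theorem reach_refill (r : Wire) (W L R : List Wire) (s : Store) :
    Reach hint acc (W.length + 2 * L.length + 2 * R.length + 5) (.clr r)
      { s with wires := W, temp := [], left := L, right := R } (.gate (some r))
      { s with wires := R ++ L, temp := [], left := [], right := [] } := by
  have h1 := reach_clr (hint := hint) (acc := acc) r W
    { s with temp := [], left := L, right := R }
  have h2 := reach_left (hint := hint) (acc := acc) r L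
    { s with wires := [], temp := [], right := R }
  have h3 := reach_left' (hint := hint) (acc := acc) r L.reverse
    { s with wires := [], left := [], right := R }
  have h4 := reach_right (hint := hint) (acc := acc) r R { s with wires := L, temp := [], left := [] }
  have h5 := reach_right' (hint := hint) (acc := acc) r R.reverse
    { s with wires := L, left := [], right := [] }
  simp only [List.append_nil, List.reverse_reverse, List.length_reverse] at h2 h3 h4 h5
  exact (h1.trans (h2.trans (h3.trans (h4.trans h5)))).mono (by omega)

end Refill

/-! ### The computed predicate -/

/-- The block of length `n` at the position `k` of a word. -/
def block (l : List Bool) (k n : ℕ) : Cube n := fun i => bit l (k + i)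

/-- The input nodes of a first block, at the position `k` of the three words `ws`. -/
def rowNodes (ws : Fin 3 → List Bool) (k n : ℕ) : Fin n → Wire :=
  fun i p _ => block (ws p) k n i

/-- The input nodes of a second block, at the position `k` of the three words `ws`. -/
def colNodes (ws : Fin 3 → List Bool) (k n : ℕ) : Fin n → Wire :=
  fun i _ q => block (ws q) k n i

/-- The number of inputs of the hint circuit. -/
def hintDim (hint : Bool) (nI nO nB : ℕ) : ℕ :=
  match hint with
  | false => nI + nB
  | true => nB + nO

/-- The input nodes of the hint circuit. -/
def hintNodes (ws : Fin 3 → List Bool) (nI nO nB : ℕ) :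
    ∀ hint : Bool, Fin (hintDim hint nI nO nB) → Wire
  | false => Fin.append (rowNodes ws 0 nI) (colNodes ws (nI + nO) nB)
  | true => Fin.append (rowNodes ws (nI + nO) nB) (colNodes ws nI nO)

theorem rows_eq (s : Store) (ws : Fin 3 → List Bool) (k n : ℕ)
    (hu : s.wordU = (ws 0).drop k) (hv : s.wordV = (ws 1).drop k)
    (hw : s.wordW = (ws 2).drop k) : rows s n = List.ofFn (rowNodes ws k n) := by
  unfold rows
  congr 1
  funext i p q
  fin_cases p <;> simp [rowWire, rowNodes, block, hu, hv, hw]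

theorem cols_eq (s : Store) (ws : Fin 3 → List Bool) (k n : ℕ)
    (hu : s.wordU = (ws 0).drop k) (hv : s.wordV = (ws 1).drop k)
    (hw : s.wordW = (ws 2).drop k) : cols s n = List.ofFn (colNodes ws k n) := by
  unfold cols
  congr 1
  funext i p q
  fin_cases q <;> simp [colWire, colNodes, block, hu, hv, hw]

/-- The stacks after the dimensions have been read. -/
theorem addBlk_addBlk_addBlk (hint : Bool) (ws : Fin 3 → List Bool) (nI nO nB : ℕ)
    (x y₁ y₂ y : List Bool) :
    ∃ L R : List Wire, R ++ L = (List.ofFn (hintNodes ws nI nO nB hint)).reverse ∧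
    addBlk hint .B nB (addBlk hint .O nO (addBlk hint .I nI
      { code := x, wordU := ws 0, wordV := ws 1, wordW := ws 2 } y₁) y₂) y =
    { code := y
      wordU := (ws 0).drop (nI + nO + nB)
      wordV := (ws 1).drop (nI + nO + nB)
      wordW := (ws 2).drop (nI + nO + nB)
      wires := (List.ofFn (Fin.append (rowNodes ws 0 nI) (colNodes ws nI nO))).reverse
      left := L
      right := R } := by
  set s₀ : Store := { code := x, wordU := ws 0, wordV := ws 1, wordW := ws 2 } with hs₀
  set s₁ := addBlk hint .I nI s₀ y₁ with hs₁
  set s₂ := addBlk hint .O nO s₁ y₂ with hs₂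
  have e0 := rows_eq s₀ ws 0 nI (by simp [hs₀]) (by simp [hs₀]) (by simp [hs₀])
  have e1 := cols_eq s₁ ws nI nO (by simp [hs₁, addBlk, hs₀]) (by simp [hs₁, addBlk, hs₀])
    (by simp [hs₁, addBlk, hs₀])
  have hu : s₂.wordU = (ws 0).drop (nI + nO) := by simp [hs₂, hs₁, addBlk, hs₀]
  have hv : s₂.wordV = (ws 1).drop (nI + nO) := by simp [hs₂, hs₁, addBlk, hs₀]
  have hw : s₂.wordW = (ws 2).drop (nI + nO) := by simp [hs₂, hs₁, addBlk, hs₀]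
  have e2 := cols_eq s₂ ws (nI + nO) nB hu hv hw
  have e3 := rows_eq s₂ ws (nI + nO) nB hu hv hw
  refine ⟨(addBlk hint .B nB s₂ y).left, (addBlk hint .B nB s₂ y).right, ?_, ?_⟩
  -- For a hint on the second component, the right block `O` is read before the left block `B`;
  -- keeping two stacks lets them be joined in the right order.
  · cases hint
    · simp [addBlk, hintNodes, List.ofFn_fin_append, hs₂, hs₁, e0, hintDim]
      simpa [hs₀] using cols_eq _ ws _ _ rfl rfl rfl
    · simp [addBlk, hintNodes, List.ofFn_fin_append, hs₂, hintDim]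
      rw [e1]
      simpa [hs₁, addBlk, hs₀] using rows_eq _ ws _ _ rfl rfl rfl
  · have hwires : s₂.wires =
        (List.ofFn (Fin.append (rowNodes ws 0 nI) (colNodes ws nI nO))).reverse := by
      have h1 : s₁.wires = (List.ofFn (rowNodes ws 0 nI)).reverse := by
        simp only [hs₁, addBlk, e0]
        simp [hs₀]
      simp only [hs₂, addBlk, e1, h1]
      simp [List.ofFn_fin_append]
    have ht : s₂.temp = [] := by simp [hs₂, hs₁, addBlk, hs₀]
    have hi : s₂.inp = [] := by simp [hs₂, hs₁, addBlk, hs₀]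
    have hr : s₂.rev = [] := by simp [hs₂, hs₁, addBlk, hs₀]
    ext1 <;> simp [addBlk, hu, hv, hw, hwires, ht, hi, hr]

/-- A bound for the time the machine needs to reach a `clean` label, given the total length of
its input. -/
def runTime (k : ℕ) : ℕ := 9 * k + 11 + 2 * ((k + 1) * (4 * k + 7))

/-- The result of the machine, which is `false` unless the code is the code of an instance. -/
def IsResult (hint : Bool) (acc : Wire → Wire → Bool) (x : List Bool) (ws : Fin 3 → List Bool)
    (res : Bool) : Prop :=
  (∃ (nI nO nB : ℕ) (c : Circuit (nI + nO)) (d : Circuit (hintDim hint nI nO nB)),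
    x = codeNat nI ++ (codeNat nO ++ (codeNat nB ++ (c.code ++ d.code))) ∧
    res = acc (c.evalWire (Fin.append (rowNodes ws 0 nI) (colNodes ws nI nO)))
      (d.evalWire (hintNodes ws nI nO nB hint))) ∨
  (∀ (nI nO nB : ℕ) (c : Circuit (nI + nO)) (d : Circuit (hintDim hint nI nO nB)),
    x ≠ codeNat nI ++ (codeNat nO ++ (codeNat nB ++ (c.code ++ d.code)))) ∧ res = false

/-! ### The complete run -/

section Run
variable {hint : Bool} {acc : Wire → Wire → Bool}

theorem chk_spec (res : Bool) (s : Store) :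
    Reach hint acc 1 (.chk res) s (.clean (s.code.isEmpty && res)) s := by
  refine Reach.step fun v => ?_
  cases h : s.code <;> simp [prog, h]

/-- The run of the machine after its input has been distributed. -/
theorem run_spec (x : List Bool) (ws : Fin 3 → List Bool) :
    ∃ res s', Reach hint acc (6 * x.length + 9 + 2 * ((x.length + 1) * (4 * x.length + 7))) (.rd .I)
        { code := x, wordU := ws 0, wordV := ws 1, wordW := ws 2 } (.clean res) s' ∧
      IsResult hint acc x ws res := by
  set s₀ : Store := { code := x, wordU := ws 0, wordV := ws 1, wordW := ws 2 } with hs₀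
  obtain ⟨N, hN⟩ : ∃ N, x.length = N := ⟨_, rfl⟩
  obtain ⟨nI, y₁, e₁, r₁⟩ | ⟨h, s', r⟩ := rd_spec (hint := hint) (acc := acc) .I s₀
  swap
  · exact ⟨false, s', r.mono (by simp [hs₀]; omega),
      .inr ⟨fun nI nO nB c d e => h nI _ e, rfl⟩⟩
  have l₁ : x.length = nI + 1 + y₁.length := by
    rw [← codeNat_length, ← List.length_append, ← e₁]
  have hx : s₀.code.length = x.length := rfl
  rw [hx] at r₁
  obtain ⟨nO, y₂, e₂, r₂⟩ | ⟨h, s', r⟩ := rd_spec (hint := hint) (acc := acc) .O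
    (addBlk hint .I nI s₀ y₁)
  swap
  · refine ⟨false, s', (r₁.trans r).mono (by simp [addBlk]; omega),
      .inr ⟨fun nI' nO' nB c d e => ?_, rfl⟩⟩
    -- Any instance with this code has the dimension already read, so the failure of the next phase
    -- excludes it.
    obtain ⟨rfl, e⟩ := codeNat_append_inj (e₁.symm.trans e)
    exact h nO' _ e
  replace e₂ : y₁ = _ := e₂
  have l₂ : y₁.length = nO + 1 + y₂.length := by
    rw [← codeNat_length, ← List.length_append, ← e₂]
  have hy₁ : (addBlk hint .I nI s₀ y₁).code.length = y₁.length := rfl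
  rw [hy₁] at r₂
  obtain ⟨nB, y₃, e₃, r₃⟩ | ⟨h, s', r⟩ := rd_spec (hint := hint) (acc := acc) .B
    (addBlk hint .O nO (addBlk hint .I nI s₀ y₁) y₂)
  swap
  · refine ⟨false, s', ((r₁.trans r₂).trans r).mono (by simp [addBlk]; omega),
      .inr ⟨fun nI' nO' nB c d e => ?_, rfl⟩⟩
    obtain ⟨rfl, e⟩ := codeNat_append_inj (e₁.symm.trans e)
    obtain ⟨rfl, e⟩ := codeNat_append_inj (e₂.symm.trans e)
    exact h nB _ e
  replace e₃ : y₂ = _ := e₃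
  have l₃ : y₂.length = nB + 1 + y₃.length := by
    rw [← codeNat_length, ← List.length_append, ← e₃]
  have hy₂ : (addBlk hint .O nO (addBlk hint .I nI s₀ y₁) y₂).code.length = y₂.length := rfl
  rw [hy₂] at r₃
  obtain ⟨L, R, hLR, e⟩ := addBlk_addBlk_addBlk hint ws nI nO nB x y₁ y₂ y₃
  rw [e] at r₃
  have hdim : hintDim hint nI nO nB ≤ nI + nO + nB := by
    cases hint <;> simp only [hintDim] <;> omega
  have hlen : R.length + L.length = hintDim hint nI nO nB := by
    have := congrArg List.length hLR
    simpa using this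
  have r₁₃ := ((r₁.trans r₂).trans r₃).mono (t' := 3 * N + 3) (by omega)
  have hT : ∀ z : List Bool, z.length ≤ N →
      (z.length + 1) * (4 * N + 7) ≤ (N + 1) * (4 * N + 7) := fun z hz =>
    Nat.mul_le_mul_right _ (by omega)
  rw [hN]
  -- Naming the only nonlinear term leaves linear time estimates.
  obtain ⟨T, hT'⟩ : ∃ T, (N + 1) * (4 * N + 7) = T := ⟨_, rfl⟩
  rw [hT'] at hT ⊢
  obtain ⟨c, y₄, W, e₄, hW, r₄⟩ | ⟨h, s', r⟩ := circuit_spec (hint := hint) (acc := acc) none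
    (Fin.append (rowNodes ws 0 nI) (colNodes ws nI nO)) y₃
    { wordU := (ws 0).drop (nI + nO + nB)
      wordV := (ws 1).drop (nI + nO + nB)
      wordW := (ws 2).drop (nI + nO + nB)
      left := L
      right := R } (t := N) (by omega)
  swap
  · refine ⟨false, s', (r₁₃.trans r).mono (by have := hT y₃ (by omega); omega),
      .inr ⟨fun nI' nO' nB' c d e => ?_, rfl⟩⟩
    obtain ⟨rfl, e⟩ := codeNat_append_inj (e₁.symm.trans e)
    obtain ⟨rfl, e⟩ := codeNat_append_inj (e₂.symm.trans e)
    obtain ⟨rfl, e⟩ := codeNat_append_inj (e₃.symm.trans e)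
    exact h c _ e
  have l₄ := congrArg List.length e₄
  rw [List.length_append] at l₄
  set rc := c.evalWire (Fin.append (rowNodes ws 0 nI) (colNodes ws nI nO)) with hrc
  have r₁₄ := (r₁₃.trans r₄).trans (reach_refill rc W L R
    { code := y₄
      wordU := (ws 0).drop (nI + nO + nB)
      wordV := (ws 1).drop (nI + nO + nB)
      wordW := (ws 2).drop (nI + nO + nB) })
  rw [hLR] at r₁₄
  replace r₁₄ := r₁₄.mono (t' := 6 * N + 8 + T) (by have := hT y₃ (by omega); omega)
  obtain ⟨d, y₅, W', e₅, hW', r₅⟩ | ⟨h, s', r⟩ := circuit_spec (hint := hint) (acc := acc)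
    (some rc) (hintNodes ws nI nO nB hint) y₄
    { wordU := (ws 0).drop (nI + nO + nB)
      wordV := (ws 1).drop (nI + nO + nB)
      wordW := (ws 2).drop (nI + nO + nB) } (t := N) (by omega)
  swap
  · refine ⟨false, s', (r₁₄.trans r).mono (by have := hT y₄ (by omega); omega),
      .inr ⟨fun nI' nO' nB' c' d' e => ?_, rfl⟩⟩
    obtain ⟨rfl, e⟩ := codeNat_append_inj (e₁.symm.trans e)
    obtain ⟨rfl, e⟩ := codeNat_append_inj (e₂.symm.trans e)
    obtain ⟨rfl, e⟩ := codeNat_append_inj (e₃.symm.trans e)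
    obtain ⟨rfl, e'⟩ := Circuit.code_append_inj (e₄.symm.trans e)
    exact h d' [] (by simpa using e')
  refine ⟨_, _, ((r₁₄.trans r₅).trans (chk_spec _ _)).mono
    (by have := hT y₄ (by omega); omega), ?_⟩
  replace e₁ : x = _ := e₁
  -- Bits left over after the second circuit make `chk` reject, rightly so since the codes are
  -- prefix-free.
  cases y₅ with
  | nil =>
    refine .inl ⟨nI, nO, nB, c, d, ?_, rfl⟩
    rw [e₁, e₂, e₃, e₄, e₅, List.append_nil]
  | cons b y₅ =>
    refine .inr ⟨fun nI' nO' nB' c' d' e => ?_, rfl⟩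
    obtain ⟨rfl, e⟩ := codeNat_append_inj (e₁.symm.trans e)
    obtain ⟨rfl, e⟩ := codeNat_append_inj (e₂.symm.trans e)
    obtain ⟨rfl, e⟩ := codeNat_append_inj (e₃.symm.trans e)
    obtain ⟨rfl, e'⟩ := Circuit.code_append_inj (e₄.symm.trans e)
    obtain ⟨rfl, e''⟩ := Circuit.code_append_inj (t := []) (e₅.symm.trans (by simpa using e'))
    simp at e''

theorem exists_result (hint : Bool) (acc : Wire → Wire → Bool)
    (a : List Bool × List Bool × List Bool × List Bool) :
    ∃ res, (∃ n ≤ 3 * runTime (quadEncoding.encode a).length + (quadEncoding.encode a).length + 1,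
      (flip bind (TM2.step (prog hint acc)))^[n]
        (some ⟨some .split, {}, ({ inp := quadEncoding.encode a } : Store).stk⟩) =
        some ⟨none, {}, ({ code := [res] } : Store).stk⟩) ∧
      IsResult hint acc a.1 ![a.2.1.reverse, a.2.2.1.reverse, a.2.2.2.reverse] res := by
  obtain ⟨x, u, v, w⟩ := a
  obtain ⟨res, s', r, h⟩ := run_spec (hint := hint) (acc := acc) x
    ![u.reverse, v.reverse, w.reverse]
  have hlen : (quadEncoding.encode (x, u, v, w)).length =
      x.length + u.length + v.length + w.length := by
    simp [quadEncoding, Computability.encodingProd, Computability.encodingList]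
    omega
  obtain ⟨n, hn, e⟩ := ((reach_input x u v w).trans r).halts {}
  refine ⟨res, ⟨n, hn.trans ?_, e⟩, h⟩
  have : stackSize ({ inp := quadEncoding.encode (x, u, v, w) } : Store).stk =
      (quadEncoding.encode (x, u, v, w)).length := by simp [stackSize_stk]
  rw [this, hlen, runTime]
  have hle : (x.length + 1) * (4 * x.length + 7) ≤ (x.length + u.length + v.length + w.length + 1) *
      (4 * (x.length + u.length + v.length + w.length) + 7) :=
    Nat.mul_le_mul (by omega) (by omega)
  omega

end Run

/-- The predicate computed by the machine. -/
noncomputable def verifier (hint : Bool) (acc : Wire → Wire → Bool)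
    (a : List Bool × List Bool × List Bool × List Bool) : Bool :=
  (exists_result hint acc a).choose

theorem verifier_isResult (hint : Bool) (acc : Wire → Wire → Bool) (x u v w : List Bool) :
    IsResult hint acc x ![u.reverse, v.reverse, w.reverse] (verifier hint acc (x, u, v, w)) :=
  (exists_result hint acc (x, u, v, w)).choose_spec.2

/-- The initial and halting configurations prescribe the state and every stack, which is why runs
end with cleaning. -/
theorem verifier_polyTime (hint : Bool) (acc : Wire → Wire → Bool) :
    Nonempty (TM2ComputableInPolyTime quadEncoding.encode Computability.encodeBool
      (verifier hint acc)) := by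
  refine ⟨{
    tm := machine hint acc
    inputAlphabet := Equiv.refl _
    outputAlphabet := Equiv.refl _
    time := 3 * (9 * .X + 11 + 2 * ((.X + 1) * (4 * .X + 7))) + .X + 1
    outputsFun := fun a => ?_ }⟩
  have h := (exists_result hint acc a).choose_spec.1
  refine ⟨⟨h.choose, ?_⟩, h.choose_spec.1.trans ?_⟩
  · have e := h.choose_spec.2
    have h0 : initList (machine hint acc) (List.map (Equiv.refl Quad).invFun
        (quadEncoding.encode a)) =
        ⟨some Lab.split, {}, ({ inp := quadEncoding.encode a } : Store).stk⟩ := by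
      unfold initList
      congr 1
      funext k
      cases k <;> simp [machine]
      rfl
    have h1 : haltList (machine hint acc) (List.map (Equiv.refl Bool).invFun
        (Computability.encodeBool (verifier hint acc a))) =
        ⟨none, {}, ({ code := [verifier hint acc a] } : Store).stk⟩ := by
      unfold haltList
      congr 1
      funext k
      cases k <;> simp [machine]
      rfl
    exact (congrArg _ (congrArg some h0)).trans (e.trans (congrArg some h1.symm))
  · simp [runTime]

/-! ### The quantifier alternation -/

section Relations
variable {A B C : Type} (R : SetRel A C)

/-- Used to bring the conditions into prenex form; nonemptiness supplies a dummy witness when `p`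
fails. -/
theorem exists_imp_of_imp_exists {α : Type} [Nonempty α] {p : Prop} {q : α → Prop}
    (h : p → ∃ x, q x) : ∃ x, p → q x := by
  by_cases hp : p
  · exact (h hp).imp fun _ hx _ => hx
  · exact ⟨Classical.arbitrary α, fun h' => absurd h' hp⟩

theorem exists_tdCondition_left [Nonempty B] [Nonempty C] (R₁ : SetRel A B) :
    (∃ R₂ : SetRel B C, TDCondition R R₁ R₂) ↔
    ∀ a c b, ∃ c' b', ∀ a',
      ((a, b) ∈ R₁ → (a', b) ∈ R₁ → (a', c') ∈ R) ∧
      ((a, c) ∈ R → (a, b') ∈ R₁ ∧ ((a', b') ∈ R₁ → (a', c) ∈ R)) := by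
  constructor
  · rintro ⟨R₂, h1, rfl⟩ a c b
    obtain ⟨c', hc'⟩ : ∃ c', (a, b) ∈ R₁ → (b, c') ∈ R₂ :=
      exists_imp_of_imp_exists fun hab => h1 ⟨a, hab⟩
    obtain ⟨b', hb'⟩ : ∃ b', (a, c) ∈ R₁.comp R₂ → (a, b') ∈ R₁ ∧ (b', c) ∈ R₂ :=
      exists_imp_of_imp_exists fun h => h
    exact ⟨c', b', fun a' => ⟨fun h h' => ⟨b, h', hc' h⟩,
      fun h => ⟨(hb' h).1, fun h' => ⟨b', h', (hb' h).2⟩⟩⟩⟩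
  · intro h
    -- The residual of `R` by `R₁`, the largest candidate.
    refine ⟨{p | ∀ a, (a, p.1) ∈ R₁ → (a, p.2) ∈ R}, ?_, ?_⟩
    · rintro b ⟨a, hab⟩
      obtain ⟨c', b', h⟩ := h a (Classical.arbitrary C) b
      exact ⟨c', fun a' h' => (h a').1 hab h'⟩
    · ext ⟨a, c⟩
      refine ⟨fun ⟨b, h1, h2⟩ => h2 a h1, fun hac => ?_⟩
      obtain ⟨c', b', h⟩ := h a c (Classical.arbitrary B)
      exact ⟨b', ((h a).2 hac).1, fun a' => ((h a').2 hac).2⟩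

/-- Once Img(R₁) ⊆ Dom(R₂), the composition has the domain of `R₁`, so only Dom(R) ⊆ Dom(R₁) remains
of the second requirement. -/
theorem exists_pdCondition_left [Nonempty B] [Nonempty C] (R₁ : SetRel A B) :
    (∃ R₂ : SetRel B C, PDCondition R R₁ R₂) ↔
    ∀ a c b, ∃ c' b', ∀ a',
      ((a, b) ∈ R₁ → (a', b) ∈ R₁ → (a', c') ∈ R) ∧ ((a, c) ∈ R → (a, b') ∈ R₁) := by
  constructor
  · rintro ⟨R₂, h1, h2, h3⟩ a c b
    obtain ⟨c', hc'⟩ : ∃ c', (a, b) ∈ R₁ → (b, c') ∈ R₂ :=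
      exists_imp_of_imp_exists fun hab => h1 ⟨a, hab⟩
    obtain ⟨b', hb'⟩ : ∃ b', (a, c) ∈ R → (a, b') ∈ R₁ := exists_imp_of_imp_exists fun h => by
      obtain ⟨c₀, b', hb', -⟩ := h2.ge ⟨c, h⟩
      exact ⟨b', hb'⟩
    exact ⟨c', b', fun a' => ⟨fun h h' => h3 ⟨b, h', hc' h⟩, hb'⟩⟩
  · intro h
    have hdom : ∀ a b, (a, b) ∈ R₁ → ∃ c, ∀ a', (a', b) ∈ R₁ → (a', c) ∈ R := fun a b hab => by
      obtain ⟨c', b', h⟩ := h a (Classical.arbitrary C) b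
      exact ⟨c', fun a' h' => (h a').1 hab h'⟩
    refine ⟨{p | ∀ a, (a, p.1) ∈ R₁ → (a, p.2) ∈ R}, ?_, ?_, ?_⟩
    · rintro b ⟨a, hab⟩
      exact hdom a b hab
    · ext a
      constructor
      · rintro ⟨c, b, h1, h2⟩
        exact ⟨c, h2 a h1⟩
      · rintro ⟨c, hac⟩
        obtain ⟨c', b', h⟩ := h a c (Classical.arbitrary B)
        obtain ⟨c₀, h₀⟩ := hdom a b' ((h a).2 hac)
        exact ⟨c₀, b', (h a).2 hac, h₀⟩
    · rintro ⟨a, c⟩ ⟨b, h1, h2⟩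
      exact h2 a h1

/-- Here Img(R₁) ⊆ Dom(R₂) can be built into the candidate, and `c` itself witnesses `b` ∈ Dom(R₂).
-/
theorem exists_tdCondition_right [Nonempty B] (R₂ : SetRel B C) :
    (∃ R₁ : SetRel A B, TDCondition R R₁ R₂) ↔
    ∀ a c, ∃ b, ∀ c', (a, c) ∈ R → (b, c) ∈ R₂ ∧ ((b, c') ∈ R₂ → (a, c') ∈ R) := by
  constructor
  · rintro ⟨R₁, h1, rfl⟩ a c
    obtain ⟨b, hb⟩ : ∃ b, (a, c) ∈ R₁.comp R₂ → (a, b) ∈ R₁ ∧ (b, c) ∈ R₂ :=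
      exists_imp_of_imp_exists fun h => h
    exact ⟨b, fun c' h => ⟨(hb h).2, fun h' => ⟨b, (hb h).1, h'⟩⟩⟩
  · intro h
    refine ⟨{p | p.2 ∈ R₂.dom ∧ ∀ c, (p.2, c) ∈ R₂ → (p.1, c) ∈ R}, ?_, ?_⟩
    · rintro b ⟨a, hb, -⟩
      exact hb
    · ext ⟨a, c⟩
      refine ⟨fun ⟨b, h1, h2⟩ => h1.2 c h2, fun hac => ?_⟩
      obtain ⟨b, h⟩ := h a c
      exact ⟨b, ⟨⟨c, (h c hac).1⟩, fun c' => (h c' hac).2⟩, (h c hac).1⟩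

/-- The composition need not contain (a,c) itself, so a separate `c''` must witness `b` ∈ Dom(R₂).
-/
theorem exists_pdCondition_right [Nonempty B] [Nonempty C] (R₂ : SetRel B C) :
    (∃ R₁ : SetRel A B, PDCondition R R₁ R₂) ↔
    ∀ a c, ∃ c'' b, ∀ c', (a, c) ∈ R → (b, c'') ∈ R₂ ∧ ((b, c') ∈ R₂ → (a, c') ∈ R) := by
  constructor
  · rintro ⟨R₁, h1, h2, h3⟩ a c
    by_cases hac : (a, c) ∈ R
    · obtain ⟨c'', b, h, h'⟩ := h2.ge ⟨c, hac⟩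
      exact ⟨c'', b, fun c' _ => ⟨h', fun h'' => h3 ⟨b, h, h''⟩⟩⟩
    · exact ⟨Classical.arbitrary C, Classical.arbitrary B, fun _ h => absurd h hac⟩
  · intro h
    have hsub : SetRel.comp {p : A × B | p.2 ∈ R₂.dom ∧ ∀ c, (p.2, c) ∈ R₂ → (p.1, c) ∈ R} R₂ ⊆ R :=
      fun ⟨a, c⟩ ⟨b, h1, h2⟩ => h1.2 c h2
    refine ⟨{p | p.2 ∈ R₂.dom ∧ ∀ c, (p.2, c) ∈ R₂ → (p.1, c) ∈ R}, ?_, ?_, hsub⟩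
    · rintro b ⟨a, hb, -⟩
      exact hb
    · ext a
      constructor
      · rintro ⟨c, hc⟩
        exact ⟨c, hsub hc⟩
      · rintro ⟨c, hac⟩
        obtain ⟨c'', b, h⟩ := h a c
        exact ⟨c'', b, ⟨⟨c'', (h c hac).1⟩, fun c' => (h c' hac).2⟩, (h c hac).1⟩

end Relations

/-! ### Quantification over words -/

/-- A point of each of the three domains. -/
abbrev Point (nI nO nB : ℕ) : Type := Cube nI × Cube nO × Cube nB

/-- The points described by a word. -/
def pointOf (nI nO nB : ℕ) (l : List Bool) : Point nI nO nB :=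
  (block l 0 nI, block l nI nO, block l (nI + nO) nB)

theorem exists_word {nI nO nB N : ℕ} (h : nI + nO + nB ≤ N) (z : Point nI nO nB) :
    ∃ u : List Bool, u.length = N ∧ pointOf nI nO nB u.reverse = z := by
  obtain ⟨a, c, b⟩ := z
  -- The blocks in the order of their dimensions in the code, padded with `false` to length `N`; the
  -- reversal cancels that of the machine.
  refine ⟨(List.ofFn a ++ (List.ofFn c ++ (List.ofFn b ++
    List.replicate (N - (nI + nO + nB)) false))).reverse, by simp; omega, ?_⟩
  rw [List.reverse_reverse]
  simp only [pointOf, Prod.mk.injEq]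
  refine ⟨?_, ?_, ?_⟩
  · funext i
    simp [block, bit, List.getElem?_append]
  · funext i
    simp [block, bit, List.getElem?_append]
  · funext i
    simp [block, bit, List.getElem?_append, Nat.add_assoc]

/-- The values of the first circuit at the nine points given by three choices of points. -/
def valR {nI nO nB : ℕ} (c : Circuit (nI + nO)) (z : Fin 3 → Point nI nO nB) : Wire :=
  fun p q => c.eval (Fin.append (z p).1 (z q).2.1)

/-- The values of the hint circuit at the nine points given by three choices of points. -/
def valH {nI nO nB : ℕ} : ∀ {hint : Bool}, Circuit (hintDim hint nI nO nB) →
    (Fin 3 → Point nI nO nB) → Wire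
  | false, d, z => fun p q => Circuit.eval (n := nI + nB) d (Fin.append (z p).1 (z q).2.2)
  | true, d, z => fun p q => Circuit.eval (n := nB + nO) d (Fin.append (z p).2.2 (z q).2.1)

theorem evalWire_append {m n : ℕ} (c : Circuit (m + n)) (f : Fin 3 → Cube m) (g : Fin 3 → Cube n) :
    c.evalWire (Fin.append (fun i p _ => f p i) (fun i _ q => g q i)) =
      fun p q => c.eval (Fin.append (f p) (g q)) := by
  funext p q
  unfold Circuit.evalWire
  congr 1
  funext i
  induction i using Fin.addCases <;> simp

theorem evalWire_valR {nI nO : ℕ} (nB : ℕ) (c : Circuit (nI + nO)) (ws : Fin 3 → List Bool) :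
    c.evalWire (Fin.append (rowNodes ws 0 nI) (colNodes ws nI nO)) =
      valR c fun p => pointOf nI nO nB (ws p) :=
  evalWire_append c (fun p => block (ws p) 0 nI) fun q => block (ws q) nI nO

theorem evalWire_valH {nI nO nB : ℕ} {hint : Bool} (d : Circuit (hintDim hint nI nO nB))
    (ws : Fin 3 → List Bool) :
    d.evalWire (hintNodes ws nI nO nB hint) = valH d fun p => pointOf nI nO nB (ws p) := by
  cases hint
  · exact evalWire_append (m := nI) (n := nB) d (fun p => block (ws p) 0 nI)
      fun q => block (ws q) (nI + nO) nB
  · exact evalWire_append (m := nB) (n := nO) d (fun p => block (ws p) (nI + nO) nB)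
      fun q => block (ws q) nI nO

/-- The code of an instance given by its components. -/
def rawCode (hint : Bool) (nI nO nB : ℕ) (c : Circuit (nI + nO))
    (d : Circuit (hintDim hint nI nO nB)) : List Bool :=
  codeNat nI ++ (codeNat nO ++ (codeNat nB ++ (c.code ++ d.code)))

/-- Although `verifier` is obtained by choice, unique readability leaves `IsResult` only this value.
-/
theorem verifier_rawCode (hint : Bool) (acc : Wire → Wire → Bool) {nI nO nB : ℕ}
    (c : Circuit (nI + nO)) (d : Circuit (hintDim hint nI nO nB)) (u v w : List Bool) :
    verifier hint acc (rawCode hint nI nO nB c d, u, v, w) =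
      acc (valR c ![pointOf nI nO nB u.reverse, pointOf nI nO nB v.reverse,
          pointOf nI nO nB w.reverse])
        (valH d ![pointOf nI nO nB u.reverse, pointOf nI nO nB v.reverse,
          pointOf nI nO nB w.reverse]) := by
  have hz : (fun p => pointOf nI nO nB (![u.reverse, v.reverse, w.reverse] p)) =
      ![pointOf nI nO nB u.reverse, pointOf nI nO nB v.reverse, pointOf nI nO nB w.reverse] := by
    funext p
    fin_cases p <;> rfl
  obtain ⟨nI', nO', nB', c', d', e, h⟩ | ⟨h, -⟩ :=
    verifier_isResult hint acc (rawCode hint nI nO nB c d) u v w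
  · rw [h, rawCode] at *
    obtain ⟨rfl, e⟩ := codeNat_append_inj e
    obtain ⟨rfl, e⟩ := codeNat_append_inj e
    obtain ⟨rfl, e⟩ := codeNat_append_inj e
    obtain ⟨rfl, e⟩ := Circuit.code_append_inj e
    obtain ⟨rfl, -⟩ := Circuit.code_append_inj (s := []) (t := []) (by simpa using e)
    rw [evalWire_valR nB, evalWire_valH, hz]
  · exact absurd rfl (h nI nO nB c d)

theorem verifier_of_ne (hint : Bool) (acc : Wire → Wire → Bool) (x u v w : List Bool)
    (h : ∀ nI nO nB c d, x ≠ rawCode hint nI nO nB c d) :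
    verifier hint acc (x, u, v, w) = false := by
  obtain ⟨nI, nO, nB, c, d, e, -⟩ | ⟨-, h'⟩ := verifier_isResult hint acc x u v w
  · exact absurd e (h nI nO nB c d)
  · exact h'

/-- A language of codes of instances is in `Π₃ᴾ` if membership is expressed by three alternating
quantifiers over points and a Boolean combination of the values of the circuits there. -/
theorem mem_piThreeP (hint : Bool) (acc : Wire → Wire → Bool) (L : Language Bool)
    (hL : ∀ x ∈ L, ∃ nI nO nB c d, x = rawCode hint nI nO nB c d)
    (hP : ∀ nI nO nB c d, rawCode hint nI nO nB c d ∈ L ↔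
      ∀ z₀ : Point nI nO nB, ∃ z₁, ∀ z₂, acc (valR c ![z₀, z₁, z₂]) (valH d ![z₀, z₁, z₂]) = true) :
    L ∈ PiThreeP := by
  -- Words of length |x| suffice, the unary dimensions summing to at most |x|.
  refine ⟨.X, verifier hint acc, verifier_polyTime hint acc, fun x => ?_⟩
  rw [Polynomial.eval_X]
  by_cases hx : ∃ nI nO nB c d, x = rawCode hint nI nO nB c d
  · obtain ⟨nI, nO, nB, c, d, rfl⟩ := hx
    rw [hP]
    have hN : nI + nO + nB ≤ (rawCode hint nI nO nB c d).length := by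
      simp [rawCode, codeNat_length]
      omega
    simp only [verifier_rawCode]
    constructor
    · intro h u _
      obtain ⟨z₁, h⟩ := h (pointOf nI nO nB u.reverse)
      obtain ⟨v, hv, rfl⟩ := exists_word hN z₁
      exact ⟨v, hv, fun w _ => h _⟩
    · intro h z₀
      obtain ⟨u, hu, rfl⟩ := exists_word hN z₀
      obtain ⟨v, -, h⟩ := h u hu
      refine ⟨pointOf nI nO nB v.reverse, fun z₂ => ?_⟩
      obtain ⟨w, hw, rfl⟩ := exists_word hN z₂
      exact h w hw
  -- Off the codes the verifier is constantly `false`; any words `u` and `w` of the right length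
  -- refute the quantified statement.
  · refine iff_of_false (fun h => hx (hL x h)) fun h => ?_
    obtain ⟨v, -, h⟩ := h (List.replicate x.length false) (by simp)
    have := h (List.replicate x.length false) (by simp)
    rw [verifier_of_ne hint acc x _ _ _ fun nI nO nB c d e => hx ⟨nI, nO, nB, c, d, e⟩] at this
    cases this

theorem HintOneInstance.code_eq_rawCode (I : HintOneInstance) :
    I.code = rawCode false I.nI I.nO I.nB I.circR I.circR₁ := by
  simp [HintOneInstance.code, rawCode]
  rfl

theorem HintTwoInstance.code_eq_rawCode (I : HintTwoInstance) :
    I.code = rawCode true I.nI I.nO I.nB I.circR I.circR₂ := by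
  simp [HintTwoInstance.code, rawCode]
  rfl

/-- The case of a hint for the first component. -/
theorem hintOne_mem_piThreeP (acc : Wire → Wire → Bool) (P : HintOneInstance → Prop)
    (hP : ∀ I : HintOneInstance, P I ↔ ∀ z₀ : Point I.nI I.nO I.nB, ∃ z₁, ∀ z₂,
      acc (valR I.circR ![z₀, z₁, z₂]) (valH (hint := false) I.circR₁ ![z₀, z₁, z₂]) = true) :
    ({x | ∃ I : HintOneInstance, I.code = x ∧ P I} : Language Bool) ∈ PiThreeP := by
  refine mem_piThreeP false acc _ ?_ fun nI nO nB c d => ?_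
  · rintro x ⟨I, rfl, -⟩
    exact ⟨_, _, _, _, _, I.code_eq_rawCode⟩
  · rw [← hP ⟨nI, nO, nB, c, d⟩]
    constructor
    · rintro ⟨I, e, h⟩
      rwa [← HintOneInstance.code_injective (e.trans
        (HintOneInstance.code_eq_rawCode ⟨nI, nO, nB, c, d⟩).symm)]
    · exact fun h => ⟨_, HintOneInstance.code_eq_rawCode ⟨nI, nO, nB, c, d⟩, h⟩

/-- The case of a hint for the second component. -/
theorem hintTwo_mem_piThreeP (acc : Wire → Wire → Bool) (P : HintTwoInstance → Prop)
    (hP : ∀ I : HintTwoInstance, P I ↔ ∀ z₀ : Point I.nI I.nO I.nB, ∃ z₁, ∀ z₂,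
      acc (valR I.circR ![z₀, z₁, z₂]) (valH (hint := true) I.circR₂ ![z₀, z₁, z₂]) = true) :
    ({x | ∃ I : HintTwoInstance, I.code = x ∧ P I} : Language Bool) ∈ PiThreeP := by
  refine mem_piThreeP true acc _ ?_ fun nI nO nB c d => ?_
  · rintro x ⟨I, rfl, -⟩
    exact ⟨_, _, _, _, _, I.code_eq_rawCode⟩
  · rw [← hP ⟨nI, nO, nB, c, d⟩]
    constructor
    · rintro ⟨I, e, h⟩
      rwa [← HintTwoInstance.code_injective (e.trans
        (HintTwoInstance.code_eq_rawCode ⟨nI, nO, nB, c, d⟩).symm)]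
    · exact fun h => ⟨_, HintTwoInstance.code_eq_rawCode ⟨nI, nO, nB, c, d⟩, h⟩

/-! ### The four languages -/

theorem symbolicTDPHintOne_mem_piThreeP : symbolicTDPHintOne ∈ PiThreeP := by
  -- The two arguments of `R` and `H` say which triple supplies the first and the second block: z₀ =
  -- (a,c,b), z₁ supplies c' and b', z₂ supplies a'. Unneeded blocks are dummy variables over
  -- nonempty cubes.
  refine hintOne_mem_piThreeP (fun R H => (!H 0 0 || !H 2 0 || R 2 1) &&
    (!R 0 0 || (H 0 1 && (!H 2 1 || R 2 0)))) _ fun I => ?_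
  rw [exists_tdCondition_left]
  simp [valR, valH, Circuit.rel, Prod.forall, Prod.exists, imp_iff_not_or, or_assoc]

theorem symbolicPDPHintOne_mem_piThreeP : symbolicPDPHintOne ∈ PiThreeP := by
  refine hintOne_mem_piThreeP (fun R H => (!H 0 0 || !H 2 0 || R 2 1) &&
    (!R 0 0 || H 0 1)) _ fun I => ?_
  rw [exists_pdCondition_left]
  simp [valR, valH, Circuit.rel, Prod.forall, Prod.exists, imp_iff_not_or, or_assoc]

theorem symbolicTDPHintTwo_mem_piThreeP : symbolicTDPHintTwo ∈ PiThreeP := by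
  refine hintTwo_mem_piThreeP (fun R H => !R 0 0 || (H 1 0 && (!H 1 2 || R 0 2))) _ fun I => ?_
  rw [exists_tdCondition_right]
  simp [valR, valH, Circuit.rel, Prod.forall, Prod.exists, imp_iff_not_or]

theorem symbolicPDPHintTwo_mem_piThreeP : symbolicPDPHintTwo ∈ PiThreeP := by
  -- `H 1 1` is (b,c'') ∈ R₂, both coordinates coming from the existential triple.
  refine hintTwo_mem_piThreeP (fun R H => !R 0 0 || (H 1 1 && (!H 1 2 || R 0 2))) _ fun I => ?_
  rw [exists_pdCondition_right]
  simp [valR, valH, Circuit.rel, Prod.forall, Prod.exists, imp_iff_not_or]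

end SeqDecomp

theorem theorem6p3 :
    (SeqDecomp.symbolicTDPHintOne ∈ SeqDecomp.PiThreeP ∧
      SeqDecomp.symbolicPDPHintOne ∈ SeqDecomp.PiThreeP) ∧
    (SeqDecomp.symbolicTDPHintTwo ∈ SeqDecomp.PiThreeP ∧
      SeqDecomp.symbolicPDPHintTwo ∈ SeqDecomp.PiThreeP) :=
  ⟨⟨SeqDecomp.symbolicTDPHintOne_mem_piThreeP, SeqDecomp.symbolicPDPHintOne_mem_piThreeP⟩,
    SeqDecomp.symbolicTDPHintTwo_mem_piThreeP, SeqDecomp.symbolicPDPHintTwo_mem_piThreeP⟩
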